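/- Let $\lambda>0$, $P>0$ and $\eta>2$. Let the base stations of a cellular network be the points $x_0,x_1,x_2,\dots$ (enumerated in any measurable way) of a homogeneous Poisson point process of intensity $\lambda$ on $\mathbb{R}^2$, all transmitting with the same power $P$. Let a test user be located at the origin, write $r_k=\|x_k\|$, and let the user be served by the nearest base station, at the service distance $r_0^{*}=\min_k r_k$. Let the fading coefficients $h_k$ be i.i.d. circularly symmetric complex Gaussian variables $\mathcal{CN}(0,1)$ (Rayleigh fading), independent of the base station locations, and let $$\mathcal{I}_{agg}=\sum_{k:\, r_k\neq r_0^{*}} P\,|h_k|^2\, r_k^{-\eta}$$ be the aggregate interference power. Then almost surely $r_0^{*}>0$ and the series $\mathcal{I}_{agg}$ converges. Moreover, for almost every value $r_0$ of the service distance (with respect to its law) and all real $z\ge 0$, the Laplace transform of the conditional distribution of $\mathcal{I}_{agg}$ given $r_0^{*}=r_0$ is $$\mathcal{L}_{\mathcal{I}_{agg}}(z)=\mathbb{E}\left[e^{-z\mathcal{I}_{agg}}\,\middle|\,r_0^{*}=r_0\right]=\exp\left\{-\frac{2\pi\lambda zP\,r_0^{2-\eta}}{\eta-2}\;{}_2F_1\!\left(1,\,1-\frac{2}{\eta};\,2-\frac{2}{\eta};\,-\frac{zP}{r_0^{\eta}}\right)\right\},$$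 where ${}_2F_1(a,b;c;\cdot)$ is the Gauss hypergeometric function, i.e. the analytic continuation to $(-\infty,1)$ of the Gauss series. If $\eta=4$, then also, for almost every $r_0$ and all $z\ge 0$, $$\mathcal{L}_{\mathcal{I}_{agg}}(z)=\exp\left\{-\pi\lambda\sqrt{zP}\,\arctan\!\left(\frac{\sqrt{zP}}{r_0^{2}}\right)\right\}.$$ -/

import Mathlib

open MeasureTheory ProbabilityTheory

noncomputable section

namespace CellularPPP

/-- The plane `ℝ²` with its Euclidean norm. -/
abbrev Plane : Type := EuclideanSpace ℝ (Fin 2)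

/-- The law `𝒞𝒩(0, 1)` on `ℂ`: independent real and imaginary parts, each centred Gaussian of
variance `1 / 2`. -/
def stdComplexGaussian : Measure ℂ :=
  ((gaussianReal 0 (1 / 2)).prod (gaussianReal 0 (1 / 2))).map fun p : ℝ × ℝ => (⟨p.1, p.2⟩ : ℂ)

variable {Ω : Type*} [MeasurableSpace Ω]

/-- The number of points of the process `x` in the set `B` (points counted with multiplicity). -/
def pointCount (x : ℕ → Ω → Plane) (B : Set Plane) (ω : Ω) : ℕ∞ :=
  {k : ℕ | x k ω ∈ B}.encard

/-- `x 0, x 1, x 2, …` is an enumeration, in some measurable order, of the points of a homogeneous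
Poisson point process of intensity `lam` on the plane: the number of points in a bounded Borel set
`B` is Poisson distributed with mean `lam` times the area of `B`, and the numbers of points in
finitely many pairwise disjoint bounded Borel sets are independent. -/
structure IsHomogeneousPPP (x : ℕ → Ω → Plane) (lam : ℝ) (μ : Measure Ω) : Prop where
  measurable : ∀ k, Measurable (x k)
  count_law : ∀ B : Set Plane, MeasurableSet B → Bornology.IsBounded B →
    HasLaw (pointCount x B)
      ((poissonMeasure (ENNReal.ofReal lam * volume B).toNNReal).map (Nat.cast : ℕ → ℕ∞)) μ
  count_indep : ∀ (n : ℕ) (B : Fin n → Set Plane), (∀ i, MeasurableSet (B i)) →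
    (∀ i, Bornology.IsBounded (B i)) → Pairwise (Function.onFun Disjoint B) →
    iIndepFun (fun i => pointCount x (B i)) μ

/-- Rayleigh fading for the process `x`: the coefficients `h k` are independent, each with law
`𝒞𝒩(0, 1)`, and the whole sequence is independent of the locations. -/
structure IsRayleighFading (h : ℕ → Ω → ℂ) (x : ℕ → Ω → Plane) (μ : Measure Ω) : Prop where
  measurable : ∀ k, Measurable (h k)
  law : ∀ k, HasLaw (h k) stdComplexGaussian μ
  indep : iIndepFun h μ
  indep_locations : IndepFun (fun ω k => h k ω) (fun ω k => x k ω) μ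

/-- The service distance `r₀`: the distance from the test user (at the origin) to the nearest
base station. -/
def serviceDistance (x : ℕ → Ω → Plane) (ω : Ω) : ℝ := ⨅ k, ‖x k ω‖

open Classical in
/-- The contribution `P |h_k|² r_k^{-η}` of the `k`-th base station to the interference power,
`r_k = ‖x_k‖`; it is zero if that base station is the serving one, i.e. the nearest one. -/
def interferenceTerm (x : ℕ → Ω → Plane) (h : ℕ → Ω → ℂ) (P η : ℝ) (k : ℕ) (ω : Ω) : ℝ :=
  if ‖x k ω‖ = serviceDistance x ω then 0 else P * ‖h k ω‖ ^ 2 * ‖x k ω‖ ^ (-η)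

/-- The aggregate interference power `I_agg = ∑_{r_k ≠ r₀} P |h_k|² r_k^{-η}`. -/
def aggregateInterference (x : ℕ → Ω → Plane) (h : ℕ → Ω → ℂ) (P η : ℝ) (ω : Ω) : ℝ :=
  ∑' k, interferenceTerm x h P η k ω

/-- The conditional Laplace transform `𝔼[exp (-z X) | R = r]`, through the regular conditional
distribution of `X` given `R`. -/
def condLaplace (μ : Measure Ω) [IsFiniteMeasure μ] (X R : Ω → ℝ) (r z : ℝ) : ℝ :=
  ∫ y, Real.exp (-z * y) ∂(condDistrib X R μ r)

lemma measurable_serviceDistance {x : ℕ → Ω → Plane} (hx : ∀ k, Measurable (x k)) :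
    Measurable (serviceDistance x) :=
  Measurable.iInf fun k => (hx k).norm

lemma measurable_aggregateInterference {x : ℕ → Ω → Plane} {h : ℕ → Ω → ℂ} {P : ℝ} (η : ℝ)
    (hx : ∀ k, Measurable (x k)) (hh : ∀ k, Measurable (h k)) (hP : 0 ≤ P) :
    Measurable (aggregateInterference x h P η) := by
  classical
  have hm : ∀ k, Measurable (interferenceTerm x h P η k) := fun k =>
    Measurable.ite (measurableSet_eq_fun (hx k).norm (measurable_serviceDistance hx))
      measurable_const ((((hh k).norm.pow_const 2).const_mul P).mul ((hx k).norm.pow_const (-η)))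
  have h0 : ∀ k ω, 0 ≤ interferenceTerm x h P η k ω := by
    intro k ω
    unfold interferenceTerm
    split_ifs
    · exact le_rfl
    · positivity
  have he : aggregateInterference x h P η =
      fun ω => (∑' k, ENNReal.ofReal (interferenceTerm x h P η k ω)).toReal := by
    funext ω
    rw [ENNReal.tsum_toReal_eq (fun k => ENNReal.ofReal_ne_top)]
    exact tsum_congr fun k => (ENNReal.toReal_ofReal (h0 k ω)).symm
  rw [he]
  exact (Measurable.ennreal_tsum fun k => (hm k).ennreal_ofReal).ennreal_toReal

/-- `F` is the analytic continuation to `(-∞, 1)` of the Gauss series `₂F₁(a, b; c; ·)`, which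
converges on `(-1, 1)`. -/
def IsGaussContinuation (a b c : ℝ) (F : ℝ → ℝ) : Prop :=
  AnalyticOnNhd ℝ F (Set.Iio 1) ∧ ∀ t, |t| < 1 → F t = ordinaryHypergeometric a b c t

/-- There is at most one such continuation. -/
lemma IsGaussContinuation.eqOn {a b c : ℝ} {F G : ℝ → ℝ} (hF : IsGaussContinuation a b c F)
    (hG : IsGaussContinuation a b c G) : Set.EqOn F G (Set.Iio 1) := by
  refine hF.1.eqOn_of_preconnected_of_eventuallyEq hG.1 isPreconnected_Iio
    (z₀ := 0) (by simp) ?_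
  filter_upwards [Metric.ball_mem_nhds (0 : ℝ) one_pos] with t ht
  have ht' : |t| < 1 := by simpa [Real.dist_eq] using ht
  rw [hF.2 t ht', hG.2 t ht']

open Classical in
/-- The Gauss hypergeometric function `₂F₁(a, b; c; t)` for real parameters and real `t < 1`: the
analytic continuation to `(-∞, 1)` of the Gauss series. (Mathlib's `ordinaryHypergeometric` is the
sum of the series, hence of no use for `t ≤ -1`; it is only the value for parameters without a
continuation, i.e. when the series is not defined.) -/
def gauss2F1 (a b c t : ℝ) : ℝ :=
  if H : ∃ F, IsGaussContinuation a b c F then H.choose t else ordinaryHypergeometric a b c t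

lemma gauss2F1_eq {a b c t : ℝ} {F : ℝ → ℝ} (hF : IsGaussContinuation a b c F) (ht : t < 1) :
    gauss2F1 a b c t = F t := by
  have H : ∃ F, IsGaussContinuation a b c F := ⟨F, hF⟩
  rw [gauss2F1, dif_pos H]
  exact H.choose_spec.eqOn hF ht

end CellularPPP

end

/-!
The Laplace functional of the Poisson process, `𝔼[exp (-∑ ψ(x_k))] = exp (-λ ∫ (1 - e^{-ψ}))`, is
proved for every measurable `ψ : ℝ² → [0, ∞]` (`laplace_functional`): for simple functions with
bounded support the sum is a linear combination of independent Poisson variables, and the general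
case follows by monotone convergence. The convention `e^{-∞} = 0` makes this one formula carry the
void probabilities and the independence statements as well: the event that a disc contains no
point is the factor that comes from `ψ = ∞` on that disc.

Let `R` be the distance to the nearest point, and round it up to the next dyadic number `b` of
generation `n`. The event that this rounding has a given value `b` only concerns the points in the
disc of radius `b`, hence is independent of the points outside. Letting `n → ∞`, `b` decreases to
`R`, and the points outside the disc increase to the points at distance greater than `R`. So, given
`R = r`, these have the Laplace functional of a Poisson process on `‖y‖ > r`
(`setLIntegral_strictOuter`). All points have distance at least `R`, so they are exactly the
interferers, and no uniqueness of the nearest point is needed.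

The fading is averaged out first, conditionally on the locations: `|h|²` is exponential, with
Laplace transform `1 / (1 + w)`, and the fading is independent of the locations. Thus an interferer
at distance `s` contributes the factor `1 / (1 + z P s^{-η})`, and the conditional Laplace transform
is `exp (-2 π λ ∫_r^∞ s · z P s^{-η} / (1 + z P s^{-η}) ds)`. The substitution `s = r v^{-1/η}` turns
the exponent into Euler's integral `b ∫₀¹ v^{b-1} / (1 - t v) dv` with `b = 1 - 2 / η` and
`t = -z P / r^η`. This integral is analytic in `t < 1` and has the Gauss series at `0`, so it is
`₂F₁(1, b; b + 1; t)`; for `b = 1 / 2` it is elementary and gives the arctangent.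

The interference is first treated as a sum in `[0, ∞]`; its finiteness follows from the limit of
the Laplace transform as `z ↓ 0`. Finally, the identities for the integrals over the events
`R ∈ A`, for each `z`, are turned into an identity for almost every `r` and all `z ≥ 0` by
continuity in `z` (`condLaplace_ae_eq`).
-/

namespace CellularPPP

open Filter Topology
open scoped ENNReal NNReal

/-! ### The Laplace functional of the Poisson process -/

section

/-- The function `t ↦ e^{-t}` on `[0, ∞]`, with `e^{-∞} = 0`. -/
noncomputable def expNeg (t : ℝ≥0∞) : ℝ≥0∞ := EReal.exp (-(t : EReal))

lemma expNeg_ofReal {t : ℝ} (ht : 0 ≤ t) :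
    expNeg (ENNReal.ofReal t) = ENNReal.ofReal (Real.exp (-t)) := by
  rw [expNeg, EReal.coe_ennreal_ofReal, max_eq_left ht, ← EReal.coe_neg, EReal.exp_coe]

@[simp] lemma expNeg_zero : expNeg 0 = 1 := by simp [expNeg]

@[simp] lemma expNeg_top : expNeg ∞ = 0 := by simp [expNeg]

lemma expNeg_add (s t : ℝ≥0∞) : expNeg (s + t) = expNeg s * expNeg t := by
  rw [expNeg, expNeg, expNeg, ← EReal.exp_add, EReal.coe_ennreal_add, EReal.neg_add,
    sub_eq_add_neg] <;> simp

lemma expNeg_sum {ι : Type*} (s : Finset ι) (f : ι → ℝ≥0∞) :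
    expNeg (∑ i ∈ s, f i) = ∏ i ∈ s, expNeg (f i) := by
  classical
  induction s using Finset.induction_on with
  | empty => simp
  | insert a s ha ih => rw [Finset.sum_insert ha, Finset.prod_insert ha, expNeg_add, ih]

lemma antitone_expNeg : Antitone expNeg := fun _ _ h =>
  EReal.exp_monotone (EReal.neg_le_neg_iff.2 (EReal.coe_ennreal_le_coe_ennreal_iff.2 h))

lemma continuous_expNeg : Continuous expNeg :=
  ENNReal.continuous_exp.comp (continuous_neg.comp continuous_coe_ennreal_ereal)

lemma measurable_expNeg : Measurable expNeg := continuous_expNeg.measurable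

lemma expNeg_le_one (t : ℝ≥0∞) : expNeg t ≤ 1 := by
  simpa using antitone_expNeg (zero_le : 0 ≤ t)

lemma expNeg_ne_top (t : ℝ≥0∞) : expNeg t ≠ ∞ :=
  ((expNeg_le_one t).trans_lt ENNReal.one_lt_top).ne

lemma expNeg_mul_natCast (c : ℝ≥0∞) (n : ℕ) : expNeg (c * n) = expNeg c ^ n := by
  have := expNeg_sum (Finset.range n) fun _ => c
  simpa [mul_comm] using this

/-- The Laplace transform of the Poisson distribution. -/
lemma lintegral_expNeg_poissonMeasure (r : ℝ≥0) (c : ℝ≥0∞) :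
    ∫⁻ n, expNeg (c * (n : ℝ≥0∞)) ∂(poissonMeasure r) = expNeg (r * (1 - expNeg c)) := by
  set q := (expNeg c).toReal with hq
  have hq0 : 0 ≤ q := ENNReal.toReal_nonneg
  have hcq : expNeg c = ENNReal.ofReal q := (ENNReal.ofReal_toReal (expNeg_ne_top c)).symm
  have hq1 : q ≤ 1 := ENNReal.toReal_le_of_le_ofReal zero_le_one (by simpa using expNeg_le_one c)
  have h1 : ∀ n : ℕ, ENNReal.ofReal (Real.exp (-r) * r ^ n / n.factorial) * expNeg (c * n) =
      ENNReal.ofReal (Real.exp (-r) * ((r * q) ^ n / n.factorial)) := by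
    intro n
    rw [expNeg_mul_natCast, hcq, ← ENNReal.ofReal_pow hq0, ← ENNReal.ofReal_mul (by positivity)]
    congr 1
    rw [mul_pow]; ring
  have hs : HasSum (fun n : ℕ => Real.exp (-r) * ((r * q) ^ n / n.factorial))
      (Real.exp (-r) * Real.exp (r * q)) := by
    refine HasSum.mul_left _ ?_
    rw [Real.exp_eq_exp_ℝ]
    exact NormedSpace.expSeries_div_hasSum_exp (r * q : ℝ)
  have h2 : (r : ℝ≥0∞) * (1 - expNeg c) = ENNReal.ofReal (r * (1 - q)) := by
    rw [hcq, ENNReal.ofReal_mul r.coe_nonneg, ENNReal.ofReal_sub _ hq0, ENNReal.ofReal_one,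
      ENNReal.ofReal_coe_nnreal]
  rw [poissonMeasure, lintegral_sum_measure, h2,
    expNeg_ofReal (mul_nonneg r.coe_nonneg (sub_nonneg.2 hq1))]
  simp only [lintegral_smul_measure, lintegral_dirac, smul_eq_mul, h1]
  rw [← ENNReal.ofReal_tsum_of_nonneg (fun n => by positivity) hs.summable, hs.tsum_eq,
    ← Real.exp_add]
  congr 2; ring

variable {Ω : Type*}

/-- The sum of `ψ` over the points of the process. -/
noncomputable def pointSum (x : ℕ → Ω → Plane) (ψ : Plane → ℝ≥0∞) (ω : Ω) : ℝ≥0∞ :=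
  ∑' k, ψ (x k ω)

lemma pointSum_indicator_const (x : ℕ → Ω → Plane) (B : Set Plane) (c : ℝ≥0∞) (ω : Ω) :
    pointSum x (B.indicator fun _ => c) ω = c * (pointCount x B ω : ℝ≥0∞) := by
  have h : ∀ k, B.indicator (fun _ => c) (x k ω) =
      ({k | x k ω ∈ B} : Set ℕ).indicator (fun _ => c) k := fun k => rfl
  unfold pointSum pointCount
  simp_rw [h]
  rw [← tsum_subtype, ENNReal.tsum_set_const, mul_comm]

variable [MeasurableSpace Ω]

lemma measurable_pointSum {x : ℕ → Ω → Plane} (hx : ∀ k, Measurable (x k)) {ψ : Plane → ℝ≥0∞}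
    (hψ : Measurable ψ) : Measurable (pointSum x ψ) :=
  Measurable.tsum fun k => hψ.comp (hx k)

lemma lintegral_expNeg_mul_pointCount {x : ℕ → Ω → Plane} {lam : ℝ} {μ : Measure Ω}
    (hx : IsHomogeneousPPP x lam μ) {B : Set Plane} (hB : MeasurableSet B)
    (hb : Bornology.IsBounded B) (c : ℝ≥0∞) :
    ∫⁻ ω, expNeg (c * (pointCount x B ω : ℝ≥0∞)) ∂μ =
      expNeg (ENNReal.ofReal lam * volume B * (1 - expNeg c)) := by
  have hm : Measurable fun n : ℕ∞ => expNeg (c * (n : ℝ≥0∞)) := measurable_from_top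
  have hfin : ENNReal.ofReal lam * volume B ≠ ∞ :=
    ENNReal.mul_ne_top ENNReal.ofReal_ne_top hb.measure_lt_top.ne
  rw [(hx.count_law B hB hb).lintegral_comp (f := fun n : ℕ∞ => expNeg (c * (n : ℝ≥0∞)))
    hm.aemeasurable, lintegral_map hm measurable_from_top]
  simp only [ENat.toENNReal_coe]
  rw [lintegral_expNeg_poissonMeasure, ENNReal.coe_toNNReal hfin]

/-- The Laplace functional of the Poisson process at a simple function cut off to a ball: there
the sum over the points is a linear combination of independent Poisson variables. -/
lemma laplace_functional_simpleFunc {x : ℕ → Ω → Plane} {lam : ℝ} {μ : Measure Ω}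
    (hx : IsHomogeneousPPP x lam μ) (f : SimpleFunc Plane ℝ≥0∞) (M : ℝ) :
    ∫⁻ ω, expNeg (pointSum x ((Metric.ball 0 M).indicator f) ω) ∂μ =
      expNeg (ENNReal.ofReal lam *
        ∫⁻ y, (1 - expNeg ((Metric.ball 0 M).indicator f y)) ∂volume) := by
  classical
  set e := f.range.equivFin
  let c : Fin f.range.card → ℝ≥0∞ := fun i => (e.symm i : ℝ≥0∞)
  let B : Fin f.range.card → Set Plane := fun i => f ⁻¹' {c i} ∩ Metric.ball 0 M
  have hBm : ∀ i, MeasurableSet (B i) := fun i =>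
    (f.measurableSet_fiber _).inter measurableSet_ball
  have hBb : ∀ i, Bornology.IsBounded (B i) := fun i =>
    Metric.isBounded_ball.subset Set.inter_subset_right
  have hcinj : Function.Injective c := fun i j hij => e.symm.injective (Subtype.ext hij)
  have hBd : Pairwise (Function.onFun Disjoint B) := by
    intro i j hij
    refine Set.disjoint_left.2 fun y hy hy' => hij (hcinj ?_)
    exact hy.1.symm.trans hy'.1
  -- at each point at most one term of the decomposition over the level sets is non-zero
  have hdec : ∀ (g : ℝ≥0∞ → ℝ≥0∞), g 0 = 0 → ∀ y,
      g ((Metric.ball 0 M).indicator f y) = ∑ i, (B i).indicator (fun _ => g (c i)) y := by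
    intro g hg y
    by_cases hy : y ∈ Metric.ball (0 : Plane) M
    · have hc : c (e ⟨f y, f.mem_range_self y⟩) = f y := by simp [c]
      rw [Finset.sum_eq_single (e ⟨f y, f.mem_range_self y⟩)]
      · rw [Set.indicator_of_mem hy, Set.indicator_of_mem, hc]
        exact ⟨hc.symm, hy⟩
      · intro j _ hj
        refine Set.indicator_of_notMem (fun h => hj (hcinj ?_)) _
        rw [hc]; exact h.1.symm
      · simp
    · rw [Set.indicator_of_notMem hy, hg]
      refine (Finset.sum_eq_zero fun i _ => Set.indicator_of_notMem (fun h => hy h.2) _).symm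
  have hsum : ∀ ω, pointSum x ((Metric.ball 0 M).indicator f) ω =
      ∑ i, c i * (pointCount x (B i) ω : ℝ≥0∞) := by
    intro ω
    simp_rw [← pointSum_indicator_const]
    unfold pointSum
    rw [← Summable.tsum_finsetSum fun i _ => ENNReal.summable]
    exact tsum_congr fun k => hdec id rfl _
  have hmeas : ∀ i, Measurable fun ω => expNeg (c i * (pointCount x (B i) ω : ℝ≥0∞)) := by
    intro i
    simp_rw [← pointSum_indicator_const]
    exact measurable_expNeg.comp
      (measurable_pointSum hx.measurable (measurable_const.indicator (hBm i)))
  have hind : iIndepFun (fun i ω => expNeg (c i * (pointCount x (B i) ω : ℝ≥0∞))) μ :=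
    (hx.count_indep _ B hBm hBb hBd).comp (fun i n => expNeg (c i * (n : ℝ≥0∞)))
      fun i => measurable_from_top
  have hint : ∫⁻ y, (1 - expNeg ((Metric.ball 0 M).indicator f y)) ∂volume =
      ∑ i, volume (B i) * (1 - expNeg (c i)) := by
    rw [lintegral_congr (hdec (fun t => 1 - expNeg t) (by simp)),
      lintegral_finsetSum _ fun i _ => measurable_const.indicator (hBm i)]
    exact Finset.sum_congr rfl fun i _ => by
      rw [lintegral_indicator_const (hBm i), mul_comm]
  simp_rw [hsum, expNeg_sum]
  rw [lintegral_prod_eq_prod_lintegral_of_indepFun _ _ hind hmeas, hint, Finset.mul_sum,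
    expNeg_sum]
  exact Finset.prod_congr rfl fun i _ => by
    rw [lintegral_expNeg_mul_pointCount hx (hBm i) (hBb i), mul_assoc]

/-- The Laplace functional of the homogeneous Poisson process, for any measurable
`ψ : ℝ² → [0, ∞]`. The value `∞` is allowed on purpose: `expNeg ∞ = 0`, so with `ψ = ∞` on a set
the left-hand side restricts to the event that this set contains no point. -/
theorem laplace_functional {x : ℕ → Ω → Plane} {lam : ℝ} {μ : Measure Ω}
    [IsProbabilityMeasure μ] (hx : IsHomogeneousPPP x lam μ) {ψ : Plane → ℝ≥0∞}
    (hψ : Measurable ψ) :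
    ∫⁻ ω, expNeg (pointSum x ψ ω) ∂μ =
      expNeg (ENNReal.ofReal lam * ∫⁻ y, (1 - expNeg (ψ y)) ∂volume) := by
  let f : ℕ → Plane → ℝ≥0∞ := fun n => (Metric.ball 0 (n : ℝ)).indicator (SimpleFunc.eapprox ψ n)
  have hfm : ∀ n, Measurable (f n) := fun n =>
    (SimpleFunc.measurable _).indicator measurableSet_ball
  have hmono : ∀ y, Monotone fun n => f n y := by
    intro y m n hmn
    refine (Set.indicator_le_indicator (SimpleFunc.monotone_eapprox ψ hmn y)).trans ?_
    exact Set.indicator_le_indicator_of_subset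
      (Metric.ball_subset_ball (by exact_mod_cast hmn)) (fun _ => zero_le) y
  have hlim : ∀ y, Tendsto (fun n => f n y) atTop (𝓝 (ψ y)) := by
    intro y
    refine (SimpleFunc.tendsto_eapprox hψ y).congr' ?_
    obtain ⟨N, hN⟩ := exists_nat_gt ‖y‖
    filter_upwards [eventually_ge_atTop N] with n hn
    refine (Set.indicator_of_mem (s := Metric.ball (0 : Plane) n) ?_ _).symm
    rw [mem_ball_zero_iff]
    exact hN.trans_le (by exact_mod_cast hn)
  have hS : ∀ ω, Tendsto (fun n => pointSum x (f n) ω) atTop (𝓝 (pointSum x ψ ω)) := by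
    intro ω
    have := lintegral_tendsto_of_tendsto_of_monotone (μ := Measure.count)
      (f := fun n k => f n (x k ω)) (F := fun k => ψ (x k ω))
      (fun n => measurable_from_top.aemeasurable) (ae_of_all _ fun k => hmono _)
      (ae_of_all _ fun k => hlim _)
    simpa [lintegral_count, pointSum] using this
  have hL : Tendsto (fun n => ∫⁻ ω, expNeg (pointSum x (f n) ω) ∂μ) atTop
      (𝓝 (∫⁻ ω, expNeg (pointSum x ψ ω) ∂μ)) := by
    refine tendsto_lintegral_of_dominated_convergence (fun _ => 1)
      (fun n => measurable_expNeg.comp (measurable_pointSum hx.measurable (hfm n)))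
      (fun n => ae_of_all _ fun ω => expNeg_le_one _) (by simp)
      (ae_of_all _ fun ω => (continuous_expNeg.tendsto _).comp (hS ω))
  have hR : Tendsto (fun n => ∫⁻ y, (1 - expNeg (f n y)) ∂volume) atTop
      (𝓝 (∫⁻ y, (1 - expNeg (ψ y)) ∂volume)) := by
    refine lintegral_tendsto_of_tendsto_of_monotone
      (fun n => (measurable_const.sub (measurable_expNeg.comp (hfm n))).aemeasurable)
      (ae_of_all _ fun y m n hmn => tsub_le_tsub_left (antitone_expNeg (hmono y hmn)) _)
      (ae_of_all _ fun y => ?_)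
    exact ENNReal.Tendsto.sub tendsto_const_nhds ((continuous_expNeg.tendsto _).comp (hlim y))
      (Or.inl ENNReal.one_ne_top)
  refine tendsto_nhds_unique hL (Tendsto.congr
    (fun n => (laplace_functional_simpleFunc hx (SimpleFunc.eapprox ψ n) n).symm) ?_)
  exact (continuous_expNeg.tendsto _).comp
    (ENNReal.Tendsto.const_mul hR (Or.inr ENNReal.ofReal_ne_top))

end

/-! ### Rayleigh fading -/

section

lemma lintegral_exp_neg_mul_sq_gaussianReal {w : ℝ} (hw : 0 ≤ w) :
    ∫⁻ a, ENNReal.ofReal (Real.exp (-(w * a ^ 2))) ∂(gaussianReal 0 (1 / 2)) =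
      ENNReal.ofReal (Real.sqrt (1 + w))⁻¹ := by
  have hint : Integrable (fun a : ℝ => Real.exp (-(w * a ^ 2))) (gaussianReal 0 (1 / 2)) := by
    refine Integrable.of_bound (by fun_prop) 1 (ae_of_all _ fun a => ?_)
    rw [Real.norm_eq_abs, Real.abs_exp, Real.exp_le_one_iff]
    have : 0 ≤ w * a ^ 2 := by positivity
    linarith
  rw [← ofReal_integral_eq_lintegral_ofReal hint (ae_of_all _ fun a => (Real.exp_pos _).le),
    integral_gaussianReal_eq_integral_smul (by norm_num)]
  congr 1
  have h : ∀ a : ℝ, gaussianPDFReal 0 (1 / 2) a • Real.exp (-(w * a ^ 2)) =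
      (Real.sqrt Real.pi)⁻¹ * Real.exp (-(1 + w) * a ^ 2) := by
    intro a
    rw [gaussianPDFReal_def]
    simp only [smul_eq_mul, NNReal.coe_div, NNReal.coe_one, NNReal.coe_ofNat]
    rw [mul_assoc, ← Real.exp_add]
    congr 3 <;> ring
  simp_rw [h]
  rw [integral_const_mul, integral_gaussian, Real.sqrt_div Real.pi_pos.le]
  have := Real.sqrt_pos.2 Real.pi_pos
  field_simp

/-- `|h|²` is a standard exponential variable: its Laplace transform is `1 / (1 + w)`, written
here as `e^{-log (1 + w)}`. -/
lemma lintegral_expNeg_stdComplexGaussian {w : ℝ} (hw : 0 ≤ w) :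
    ∫⁻ ζ, expNeg (ENNReal.ofReal (w * ‖ζ‖ ^ 2)) ∂stdComplexGaussian =
      expNeg (ENNReal.ofReal (Real.log (1 + w))) := by
  have hm : Measurable fun p : ℝ × ℝ => (⟨p.1, p.2⟩ : ℂ) :=
    Complex.measurableEquivRealProd.symm.measurable
  have hm1 : Measurable fun ζ : ℂ => expNeg (ENNReal.ofReal (w * ‖ζ‖ ^ 2)) :=
    measurable_expNeg.comp (by fun_prop)
  have hm2 : Measurable fun a : ℝ => ENNReal.ofReal (Real.exp (-(w * a ^ 2))) := by fun_prop
  have h : ∀ p : ℝ × ℝ, expNeg (ENNReal.ofReal (w * ‖(⟨p.1, p.2⟩ : ℂ)‖ ^ 2)) =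
      ENNReal.ofReal (Real.exp (-(w * p.1 ^ 2))) * ENNReal.ofReal (Real.exp (-(w * p.2 ^ 2))) := by
    intro p
    rw [expNeg_ofReal (by positivity), ← ENNReal.ofReal_mul (Real.exp_pos _).le, ← Real.exp_add,
      Complex.sq_norm, Complex.normSq_mk]
    congr 2; ring
  rw [stdComplexGaussian, lintegral_map hm1 hm]
  simp_rw [h]
  rw [lintegral_prod_mul hm2.aemeasurable hm2.aemeasurable,
    lintegral_exp_neg_mul_sq_gaussianReal hw, ← ENNReal.ofReal_mul (by positivity),
    expNeg_ofReal (Real.log_nonneg (by linarith)), Real.exp_neg, Real.exp_log (by linarith),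
    ← mul_inv, Real.mul_self_sqrt (by linarith)]

variable {Ω : Type*} [MeasurableSpace Ω]

lemma lintegral_expNeg_tsum_fading {h : ℕ → Ω → ℂ} {x : ℕ → Ω → Plane} {μ : Measure Ω}
    [IsProbabilityMeasure μ] (hh : IsRayleighFading h x μ) {w : ℕ → ℝ} (hw : ∀ k, 0 ≤ w k) :
    ∫⁻ ω, expNeg (∑' k, ENNReal.ofReal (w k * ‖h k ω‖ ^ 2)) ∂μ =
      expNeg (∑' k, ENNReal.ofReal (Real.log (1 + w k))) := by
  have hg : ∀ k, Measurable fun ζ : ℂ => expNeg (ENNReal.ofReal (w k * ‖ζ‖ ^ 2)) := fun k =>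
    measurable_expNeg.comp (by fun_prop)
  have hfin : ∀ n, ∫⁻ ω, expNeg (∑ k ∈ Finset.range n, ENNReal.ofReal (w k * ‖h k ω‖ ^ 2)) ∂μ =
      expNeg (∑ k ∈ Finset.range n, ENNReal.ofReal (Real.log (1 + w k))) := by
    intro n
    simp_rw [expNeg_sum]
    rw [lintegral_prod_eq_prod_lintegral_of_indepFun _
      (fun k ω => expNeg (ENNReal.ofReal (w k * ‖h k ω‖ ^ 2)))
      (hh.indep.comp (fun k ζ => expNeg (ENNReal.ofReal (w k * ‖ζ‖ ^ 2))) hg)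
      fun k => (hg k).comp (hh.measurable k)]
    refine Finset.prod_congr rfl fun k _ => ?_
    rw [← lintegral_expNeg_stdComplexGaussian (hw k), ← (hh.law k).lintegral_comp
      (f := fun ζ => expNeg (ENNReal.ofReal (w k * ‖ζ‖ ^ 2))) (hg k).aemeasurable]
  have hL := tendsto_lintegral_of_dominated_convergence (μ := μ)
    (F := fun n ω => expNeg (∑ k ∈ Finset.range n, ENNReal.ofReal (w k * ‖h k ω‖ ^ 2)))
    (f := fun ω => expNeg (∑' k, ENNReal.ofReal (w k * ‖h k ω‖ ^ 2))) (fun _ => 1)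
    (fun n => measurable_expNeg.comp <| Finset.measurable_fun_sum _ fun k _ =>
      (((hh.measurable k).norm.pow_const 2).const_mul (w k)).ennreal_ofReal)
    (fun n => ae_of_all _ fun ω => expNeg_le_one _) (by simp)
    (ae_of_all _ fun ω => (continuous_expNeg.tendsto _).comp
      ENNReal.summable.hasSum.tendsto_sum_nat)
  refine tendsto_nhds_unique (hL.congr hfin) ?_
  exact (continuous_expNeg.tendsto _).comp ENNReal.summable.hasSum.tendsto_sum_nat

/-- Averaging over the fading, with weights and a test function that depend on the locations. -/
lemma lintegral_mul_expNeg_fading {h : ℕ → Ω → ℂ} {x : ℕ → Ω → Plane} {μ : Measure Ω}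
    [IsProbabilityMeasure μ] (hh : IsRayleighFading h x μ) (hx : ∀ k, Measurable (x k))
    {F : (ℕ → Plane) → ℝ≥0∞} (hF : Measurable F) {W : ℕ → (ℕ → Plane) → ℝ}
    (hWm : ∀ k, Measurable (W k)) (hW : ∀ k s, 0 ≤ W k s) :
    ∫⁻ ω, F (fun k => x k ω) *
        expNeg (∑' k, ENNReal.ofReal (W k (fun k => x k ω) * ‖h k ω‖ ^ 2)) ∂μ =
      ∫⁻ ω, F (fun k => x k ω) *
        expNeg (∑' k, ENNReal.ofReal (Real.log (1 + W k (fun k => x k ω)))) ∂μ := by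
  have hxm : Measurable fun ω k => x k ω := measurable_pi_iff.2 hx
  have hhm : Measurable fun ω k => h k ω := measurable_pi_iff.2 hh.measurable
  have hG : Measurable fun p : (ℕ → ℂ) × (ℕ → Plane) =>
      F p.2 * expNeg (∑' k, ENNReal.ofReal (W k p.2 * ‖p.1 k‖ ^ 2)) := by
    refine (hF.comp measurable_snd).mul (measurable_expNeg.comp (Measurable.tsum fun k => ?_))
    exact (((hWm k).comp measurable_snd).mul
      (((measurable_pi_apply k).comp measurable_fst).norm.pow_const 2)).ennreal_ofReal
  have hG2 : Measurable fun s : ℕ → Plane =>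
      F s * expNeg (∑' k, ENNReal.ofReal (Real.log (1 + W k s))) :=
    hF.mul (measurable_expNeg.comp (Measurable.tsum fun k =>
      (Real.measurable_log.comp ((hWm k).const_add 1)).ennreal_ofReal))
  have hmap := (indepFun_iff_map_prod_eq_prod_map_map hhm.aemeasurable hxm.aemeasurable).1
    hh.indep_locations
  have := Measure.isProbabilityMeasure_map (μ := μ) hhm.aemeasurable
  have := Measure.isProbabilityMeasure_map (μ := μ) hxm.aemeasurable
  rw [← lintegral_map hG (hhm.prodMk hxm), hmap, lintegral_prod_symm _ hG.aemeasurable,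
    ← lintegral_map hG2 hxm]
  refine lintegral_congr fun s => ?_
  simp only
  rw [← lintegral_expNeg_tsum_fading hh fun k => hW k s]
  refine (lintegral_map (hG.comp (measurable_prodMk_right (y := s))) hhm).trans ?_
  have hm : Measurable fun ω => ∑' k, ENNReal.ofReal (W k s * ‖h k ω‖ ^ 2) :=
    Measurable.tsum fun k => (((hh.measurable k).norm.pow_const 2).const_mul _).ennreal_ofReal
  simp only [Function.comp_apply]
  exact lintegral_const_mul (F s) (measurable_expNeg.comp hm)

end

/-! ### The points beyond the nearest one -/

section

section Dyadic

/-- The smallest multiple of `2⁻ⁿ` which is strictly greater than `r` (for `r ≥ 0`). -/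
noncomputable def dyadicAbove (n : ℕ) (r : ℝ) : ℝ := (⌊2 ^ n * r⌋₊ + 1) / 2 ^ n

lemma lt_dyadicAbove (n : ℕ) (r : ℝ) : r < dyadicAbove n r := by
  rw [dyadicAbove, lt_div_iff₀ (by positivity), mul_comm]
  exact Nat.lt_floor_add_one _

lemma dyadicAbove_le (n : ℕ) {r : ℝ} (hr : 0 ≤ r) : dyadicAbove n r ≤ r + (1 / 2) ^ n := by
  rw [dyadicAbove, div_le_iff₀ (by positivity), add_mul, ← mul_pow, mul_comm r]
  have := Nat.floor_le (show 0 ≤ 2 ^ n * r by positivity)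
  norm_num
  exact this

lemma dyadicAbove_antitone {r : ℝ} (hr : 0 ≤ r) : Antitone fun n => dyadicAbove n r := by
  refine antitone_nat_of_succ_le fun n => ?_
  have h1 : ⌊2 ^ (n + 1) * r⌋₊ < 2 * (⌊2 ^ n * r⌋₊ + 1) := by
    rw [Nat.floor_lt (by positivity)]
    push_cast
    have := Nat.lt_floor_add_one (2 ^ n * r)
    rw [pow_succ]
    linarith
  have h2 : (⌊2 ^ (n + 1) * r⌋₊ : ℝ) + 1 ≤ 2 * (⌊2 ^ n * r⌋₊ + 1) := by exact_mod_cast h1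
  rw [dyadicAbove, dyadicAbove, div_le_div_iff₀ (by positivity) (by positivity)]
  have h3 := mul_le_mul_of_nonneg_right h2 (show (0 : ℝ) ≤ 2 ^ n by positivity)
  refine h3.trans (le_of_eq ?_)
  rw [pow_succ]; ring

lemma tendsto_dyadicAbove {r : ℝ} (hr : 0 ≤ r) :
    Tendsto (fun n => dyadicAbove n r) atTop (𝓝 r) := by
  refine tendsto_of_tendsto_of_tendsto_of_le_of_le tendsto_const_nhds ?_
    (fun n => (lt_dyadicAbove n r).le) (fun n => dyadicAbove_le n hr)
  have := tendsto_pow_atTop_nhds_zero_of_lt_one (r := (1 / 2 : ℝ)) (by norm_num) (by norm_num)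
  simpa using this.const_add r

end Dyadic

/-- `ψ` cut off to the closed exterior `‖y‖ ≥ b`. -/
noncomputable def outer (ψ : Plane → ℝ≥0∞) (b : ℝ) : Plane → ℝ≥0∞ :=
  (Metric.ball 0 b)ᶜ.indicator ψ

/-- `ψ` cut off to the open exterior `‖y‖ > r`. -/
noncomputable def strictOuter (ψ : Plane → ℝ≥0∞) (r : ℝ) : Plane → ℝ≥0∞ :=
  (Metric.closedBall 0 r)ᶜ.indicator ψ

lemma outer_apply (ψ : Plane → ℝ≥0∞) (b : ℝ) (y : Plane) :
    outer ψ b y = if b ≤ ‖y‖ then ψ y else 0 := by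
  by_cases h : b ≤ ‖y‖
  · rw [if_pos h]
    exact Set.indicator_of_mem (by simpa using h) _
  · rw [if_neg h]
    exact Set.indicator_of_notMem (by simpa using h) _

lemma strictOuter_apply (ψ : Plane → ℝ≥0∞) (r : ℝ) (y : Plane) :
    strictOuter ψ r y = if r < ‖y‖ then ψ y else 0 := by
  by_cases h : r < ‖y‖
  · rw [if_pos h]
    exact Set.indicator_of_mem (by simpa using h) _
  · rw [if_neg h]
    exact Set.indicator_of_notMem (by simpa using h) _

/-- The Laplace functional `exp (-λ ∫ (1 - e^{-ψ}))` of the Poisson process of intensity `λ`. -/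
noncomputable def poissonLaplace (lam : ℝ) (ψ : Plane → ℝ≥0∞) : ℝ≥0∞ :=
  expNeg (ENNReal.ofReal lam * ∫⁻ y, (1 - expNeg (ψ y)) ∂volume)

lemma measurable_outer {ψ : Plane → ℝ≥0∞} (hψ : Measurable ψ) (b : ℝ) :
    Measurable (outer ψ b) := hψ.indicator measurableSet_ball.compl

lemma outer_dyadicAbove_mono (ψ : Plane → ℝ≥0∞) {r : ℝ} (hr : 0 ≤ r) (y : Plane) :
    Monotone fun n => outer ψ (dyadicAbove n r) y := fun _ _ hmn =>
  Set.indicator_le_indicator_of_subset (Set.compl_subset_compl.2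
    (Metric.ball_subset_ball (dyadicAbove_antitone hr hmn))) (fun _ => zero_le) y

lemma tendsto_outer_dyadicAbove (ψ : Plane → ℝ≥0∞) {r : ℝ} (hr : 0 ≤ r) (y : Plane) :
    Tendsto (fun n => outer ψ (dyadicAbove n r) y) atTop (𝓝 (strictOuter ψ r y)) := by
  refine tendsto_const_nhds.congr' ?_
  by_cases hy : r < ‖y‖
  · filter_upwards [(tendsto_dyadicAbove hr).eventually_lt_const hy] with n hn
    rw [outer_apply, strictOuter_apply, if_pos hy, if_pos hn.le]
  · refine Eventually.of_forall fun n => ?_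
    change strictOuter ψ r y = outer ψ (dyadicAbove n r) y
    rw [outer_apply, strictOuter_apply, if_neg hy,
      if_neg (not_le.2 ((not_lt.1 hy).trans_lt (lt_dyadicAbove n r)))]

lemma tendsto_poissonLaplace_outer (lam : ℝ) {ψ : Plane → ℝ≥0∞} (hψ : Measurable ψ) {r : ℝ}
    (hr : 0 ≤ r) :
    Tendsto (fun n => poissonLaplace lam (outer ψ (dyadicAbove n r))) atTop
      (𝓝 (poissonLaplace lam (strictOuter ψ r))) := by
  refine (continuous_expNeg.tendsto _).comp
    (ENNReal.Tendsto.const_mul ?_ (Or.inr ENNReal.ofReal_ne_top))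
  refine lintegral_tendsto_of_tendsto_of_monotone
    (fun n => (measurable_const.sub (measurable_expNeg.comp (measurable_outer hψ _))).aemeasurable)
    (ae_of_all _ fun y m n hmn =>
      tsub_le_tsub_left (antitone_expNeg (outer_dyadicAbove_mono ψ hr y hmn)) _)
    (ae_of_all _ fun y => ?_)
  exact ENNReal.Tendsto.sub tendsto_const_nhds
    ((continuous_expNeg.tendsto _).comp (tendsto_outer_dyadicAbove ψ hr y))
    (Or.inl ENNReal.one_ne_top)

section

variable {Ω : Type*}

lemma serviceDistance_nonneg (x : ℕ → Ω → Plane) (ω : Ω) : 0 ≤ serviceDistance x ω :=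
  Real.iInf_nonneg fun _ => norm_nonneg _

lemma serviceDistance_le (x : ℕ → Ω → Plane) (ω : Ω) (k : ℕ) : serviceDistance x ω ≤ ‖x k ω‖ :=
  ciInf_le ⟨0, by rintro _ ⟨k, rfl⟩; exact norm_nonneg _⟩ k

lemma le_serviceDistance_iff (x : ℕ → Ω → Plane) (ω : Ω) (a : ℝ) :
    a ≤ serviceDistance x ω ↔ ∀ k, a ≤ ‖x k ω‖ :=
  ⟨fun h k => h.trans (serviceDistance_le x ω k), fun h => le_ciInf h⟩

lemma tendsto_pointSum_outer (x : ℕ → Ω → Plane) (ψ : Plane → ℝ≥0∞) {r : ℝ} (hr : 0 ≤ r)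
    (ω : Ω) :
    Tendsto (fun n => pointSum x (outer ψ (dyadicAbove n r)) ω) atTop
      (𝓝 (pointSum x (strictOuter ψ r) ω)) := by
  have := lintegral_tendsto_of_tendsto_of_monotone (μ := Measure.count)
    (f := fun n k => outer ψ (dyadicAbove n r) (x k ω)) (F := fun k => strictOuter ψ r (x k ω))
    (fun n => measurable_from_top.aemeasurable)
    (ae_of_all _ fun k => outer_dyadicAbove_mono ψ hr _)
    (ae_of_all _ fun k => tendsto_outer_dyadicAbove ψ hr _)
  simpa [lintegral_count, pointSum] using this

/-- The value `∞` on the ball of radius `a` turns the Laplace functional into an expectation over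
the event that there is no point in that ball. -/
lemma expNeg_pointSum_add_indicator_top (x : ℕ → Ω → Plane) (ψ : Plane → ℝ≥0∞) (a : ℝ) (ω : Ω) :
    expNeg (pointSum x (fun y => ψ y + (Metric.ball 0 a).indicator (fun _ => ∞) y) ω) =
      {ω | a ≤ serviceDistance x ω}.indicator (fun ω => expNeg (pointSum x ψ ω)) ω := by
  by_cases h : a ≤ serviceDistance x ω
  · rw [Set.indicator_of_mem (by exact h)]
    congr 1
    refine tsum_congr fun k => ?_
    dsimp only
    rw [Set.indicator_of_notMem, add_zero]
    simpa using (le_serviceDistance_iff x ω a).1 h k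
  · rw [Set.indicator_of_notMem (by exact h)]
    rw [le_serviceDistance_iff, not_forall] at h
    obtain ⟨k, hk⟩ := h
    have : pointSum x (fun y => ψ y + (Metric.ball 0 a).indicator (fun _ => ∞) y) ω = ∞ := by
      refine ENNReal.tsum_eq_top_of_eq_top ⟨k, ?_⟩
      have hmem : x k ω ∈ Metric.ball (0 : Plane) a := by simpa using hk
      dsimp only
      rw [Set.indicator_of_mem hmem, add_top]
    rw [this, expNeg_top]

variable [MeasurableSpace Ω] {x : ℕ → Ω → Plane} {lam : ℝ} {μ : Measure Ω}

lemma measurable_expNeg_pointSum (hx : ∀ k, Measurable (x k)) {ψ : Plane → ℝ≥0∞}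
    (hψ : Measurable ψ) : Measurable fun ω => expNeg (pointSum x ψ ω) :=
  measurable_expNeg.comp (measurable_pointSum hx hψ)

lemma measurableSet_le_serviceDistance (hx : ∀ k, Measurable (x k)) (a : ℝ) :
    MeasurableSet {ω | a ≤ serviceDistance x ω} :=
  measurableSet_le measurable_const (measurable_serviceDistance hx)

lemma lintegral_eq_tsum_fiber {J : Ω → ℕ} (hJ : Measurable J) (Φ : ℕ → Ω → ℝ≥0∞) :
    ∫⁻ ω, Φ (J ω) ω ∂μ = ∑' j, ∫⁻ ω in J ⁻¹' {j}, Φ j ω ∂μ := by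
  have hm : ∀ j, MeasurableSet (J ⁻¹' {j}) := fun j => hJ (measurableSet_singleton j)
  have hu : (⋃ j, J ⁻¹' {j}) = Set.univ := by ext; simp
  rw [← setLIntegral_univ, ← hu, lintegral_iUnion hm]
  · refine tsum_congr fun j => setLIntegral_congr_fun (hm j) fun ω hω => ?_
    simp only [Set.mem_preimage, Set.mem_singleton_iff] at hω
    simp only [hω]
  · intro i j hij
    refine Set.disjoint_left.2 fun ω h h' => hij (h.symm.trans h')

variable [IsProbabilityMeasure μ]

/-- Void probabilities of discs. -/
lemma measure_le_serviceDistance (hx : IsHomogeneousPPP x lam μ) (a : ℝ) :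
    μ {ω | a ≤ serviceDistance x ω} =
      expNeg (ENNReal.ofReal lam * volume (Metric.ball (0 : Plane) a)) := by
  have h := laplace_functional hx (ψ := fun y => (0 : ℝ≥0∞) +
    (Metric.ball (0 : Plane) a).indicator (fun _ => ∞) y)
    (Measurable.fun_add measurable_const (measurable_const.indicator measurableSet_ball))
  simp_rw [expNeg_pointSum_add_indicator_top x (fun _ => 0) a] at h
  rw [lintegral_indicator (measurableSet_le_serviceDistance hx.measurable a)] at h
  have h1 : ∀ y, 1 - expNeg (0 + (Metric.ball (0 : Plane) a).indicator (fun _ => ∞) y) =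
      (Metric.ball (0 : Plane) a).indicator (fun _ => 1) y := by
    intro y
    by_cases hy : y ∈ Metric.ball (0 : Plane) a <;> simp [hy]
  simp_rw [h1] at h
  rw [lintegral_indicator_const measurableSet_ball, one_mul] at h
  simpa [pointSum] using h

lemma setLIntegral_le_serviceDistance_outer (hx : IsHomogeneousPPP x lam μ)
    {ψ : Plane → ℝ≥0∞} (hψ : Measurable ψ) {a b : ℝ} (hab : a ≤ b) :
    ∫⁻ ω in {ω | a ≤ serviceDistance x ω}, expNeg (pointSum x (outer ψ b) ω) ∂μ =
      poissonLaplace lam (outer ψ b) * μ {ω | a ≤ serviceDistance x ω} := by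
  have hm := measurable_outer hψ b
  have h := laplace_functional hx (ψ := fun y => outer ψ b y +
    (Metric.ball (0 : Plane) a).indicator (fun _ => ∞) y)
    (hm.add (measurable_const.indicator measurableSet_ball))
  simp_rw [expNeg_pointSum_add_indicator_top x (outer ψ b) a] at h
  rw [lintegral_indicator (measurableSet_le_serviceDistance hx.measurable a)] at h
  have h1 : ∀ y, 1 - expNeg (outer ψ b y +
        (Metric.ball (0 : Plane) a).indicator (fun _ => ∞) y) =
      (1 - expNeg (outer ψ b y)) + (Metric.ball (0 : Plane) a).indicator (fun _ => 1) y := by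
    intro y
    by_cases hy : y ∈ Metric.ball (0 : Plane) a
    · simp [outer, hy, Metric.ball_subset_ball hab hy]
    · simp [hy]
  simp_rw [h1] at h
  have hm' : Measurable fun y => 1 - expNeg (outer ψ b y) :=
    measurable_const.sub (measurable_expNeg.comp hm)
  rw [lintegral_add_left hm',
    lintegral_indicator_const measurableSet_ball, one_mul, mul_add, expNeg_add,
    ← measure_le_serviceDistance hx] at h
  exact h

/-- The points at distance at least `b` are independent of the event that the nearest point has
distance in `[a, b)`, which only concerns the points in the disc of radius `b`. -/
lemma setLIntegral_serviceDistance_Ico_outer (hx : IsHomogeneousPPP x lam μ)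
    {ψ : Plane → ℝ≥0∞} (hψ : Measurable ψ) {a b : ℝ} (hab : a ≤ b) :
    ∫⁻ ω in serviceDistance x ⁻¹' Set.Ico a b, expNeg (pointSum x (outer ψ b) ω) ∂μ =
      poissonLaplace lam (outer ψ b) * μ (serviceDistance x ⁻¹' Set.Ico a b) := by
  have hB := measurableSet_le_serviceDistance hx.measurable b
  have hu : {ω | a ≤ serviceDistance x ω} =
      serviceDistance x ⁻¹' Set.Ico a b ∪ {ω | b ≤ serviceDistance x ω} := by
    ext ω
    simp only [Set.mem_ofPred_eq, Set.mem_union, Set.mem_preimage, Set.mem_Ico]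
    constructor
    · intro h
      rcases lt_or_ge (serviceDistance x ω) b with h' | h'
      exacts [Or.inl ⟨h, h'⟩, Or.inr h']
    · rintro (h | h)
      exacts [h.1, hab.trans h]
  have hd : Disjoint (serviceDistance x ⁻¹' Set.Ico a b) {ω | b ≤ serviceDistance x ω} :=
    Set.disjoint_left.2 fun ω h h' => (not_lt.2 h') h.2
  have ha := setLIntegral_le_serviceDistance_outer hx hψ hab
  have hb := setLIntegral_le_serviceDistance_outer hx hψ (le_refl b)
  rw [hu, lintegral_union hB hd, measure_union hd hB, mul_add, hb] at ha
  exact (ENNReal.add_left_inj (ENNReal.mul_ne_top (expNeg_ne_top _) (measure_ne_top _ _))).1 ha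

lemma lintegral_dyadicAbove_outer (hx : IsHomogeneousPPP x lam μ) {ψ : Plane → ℝ≥0∞}
    (hψ : Measurable ψ) (f : ℝ → ℝ≥0∞) (n : ℕ) :
    ∫⁻ ω, f (dyadicAbove n (serviceDistance x ω)) *
        expNeg (pointSum x (outer ψ (dyadicAbove n (serviceDistance x ω))) ω) ∂μ =
      ∫⁻ ω, f (dyadicAbove n (serviceDistance x ω)) *
        poissonLaplace lam (outer ψ (dyadicAbove n (serviceDistance x ω))) ∂μ := by
  have hJ : Measurable fun ω => ⌊2 ^ n * serviceDistance x ω⌋₊ :=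
    ((measurable_serviceDistance hx.measurable).const_mul _).nat_floor
  have h1 := lintegral_eq_tsum_fiber (μ := μ) hJ fun j ω => f ((j + 1) / 2 ^ n) *
    expNeg (pointSum x (outer ψ ((j + 1) / 2 ^ n)) ω)
  have h2 := lintegral_eq_tsum_fiber (μ := μ) hJ fun j _ => f ((j + 1) / 2 ^ n) *
    poissonLaplace lam (outer ψ ((j + 1) / 2 ^ n))
  refine h1.trans (Eq.trans (tsum_congr fun j => ?_) h2.symm)
  have hpre : (fun ω => ⌊2 ^ n * serviceDistance x ω⌋₊) ⁻¹' {j} =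
      serviceDistance x ⁻¹' Set.Ico (j / 2 ^ n) ((j + 1) / 2 ^ n) := by
    ext ω
    have hp : (0 : ℝ) < 2 ^ n := by positivity
    rw [Set.mem_preimage, Set.mem_singleton_iff, Nat.floor_eq_iff
      (mul_nonneg hp.le (serviceDistance_nonneg x ω)), Set.mem_preimage, Set.mem_Ico,
      div_le_iff₀ hp, lt_div_iff₀ hp, mul_comm]
  rw [hpre, lintegral_const_mul _
    (measurable_expNeg_pointSum hx.measurable (measurable_outer hψ _)),
    setLIntegral_serviceDistance_Ico_outer hx hψ (by gcongr; linarith), setLIntegral_const,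
    mul_assoc]

lemma lintegral_strictOuter (hx : IsHomogeneousPPP x lam μ) {ψ : Plane → ℝ≥0∞}
    (hψ : Measurable ψ) (f : BoundedContinuousFunction ℝ ℝ≥0) :
    ∫⁻ ω, f (serviceDistance x ω) *
        expNeg (pointSum x (strictOuter ψ (serviceDistance x ω)) ω) ∂μ =
      ∫⁻ ω, f (serviceDistance x ω) *
        poissonLaplace lam (strictOuter ψ (serviceDistance x ω)) ∂μ := by
  have hR := measurable_serviceDistance hx.measurable
  have hdy : ∀ n, Measurable fun ω => dyadicAbove n (serviceDistance x ω) := fun n =>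
    ((measurable_from_top.comp (hR.const_mul _).nat_floor).add_const 1).div_const _
  have hbd : ∀ r, (f r : ℝ≥0∞) ≤ (nndist f 0 : ℝ≥0) := fun r =>
    ENNReal.coe_le_coe.2 (BoundedContinuousFunction.NNReal.upper_bound f r)
  have hflim : ∀ ω, Tendsto (fun n => (f (dyadicAbove n (serviceDistance x ω)) : ℝ≥0∞)) atTop
      (𝓝 (f (serviceDistance x ω))) := fun ω =>
    ENNReal.tendsto_coe.2 ((f.continuous.tendsto _).comp
      (tendsto_dyadicAbove (serviceDistance_nonneg x ω)))
  have hfm : ∀ n, Measurable fun ω => (f (dyadicAbove n (serviceDistance x ω)) : ℝ≥0∞) := fun n =>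
    (f.continuous.measurable.comp (hdy n)).coe_nnreal_ennreal
  -- both integrands at stage `n` are functions of an integer-valued variable
  have hcount : ∀ n (Φ : ℝ → Ω → ℝ≥0∞), (∀ b, Measurable (Φ b)) →
      Measurable fun ω => Φ (dyadicAbove n (serviceDistance x ω)) ω := by
    intro n Φ hΦ
    have : Measurable fun p : ℕ × Ω => Φ ((p.1 + 1) / 2 ^ n) p.2 :=
      measurable_from_prod_countable_right fun j => hΦ ((j + 1) / 2 ^ n)
    exact this.comp (((hR.const_mul _).nat_floor).prodMk measurable_id)
  have hL := tendsto_lintegral_of_dominated_convergence (μ := μ)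
    (F := fun n ω => f (dyadicAbove n (serviceDistance x ω)) *
      expNeg (pointSum x (outer ψ (dyadicAbove n (serviceDistance x ω))) ω))
    (f := fun ω => f (serviceDistance x ω) *
      expNeg (pointSum x (strictOuter ψ (serviceDistance x ω)) ω))
    (fun _ => (nndist f 0 : ℝ≥0))
    (fun n => (hfm n).mul (hcount n (fun b ω => expNeg (pointSum x (outer ψ b) ω)) fun b =>
      measurable_expNeg.comp (measurable_pointSum hx.measurable (measurable_outer hψ b))))
    (fun n => ae_of_all _ fun ω => (mul_le_mul' (hbd _) (expNeg_le_one _)).trans (by simp))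
    (by simp)
    (ae_of_all _ fun ω => ENNReal.Tendsto.mul (hflim ω) (Or.inr (expNeg_ne_top _))
      ((continuous_expNeg.tendsto _).comp
        (tendsto_pointSum_outer x ψ (serviceDistance_nonneg x ω) ω)) (Or.inr ENNReal.coe_ne_top))
  have hRt := tendsto_lintegral_of_dominated_convergence (μ := μ)
    (F := fun n ω => f (dyadicAbove n (serviceDistance x ω)) *
      poissonLaplace lam (outer ψ (dyadicAbove n (serviceDistance x ω))))
    (f := fun ω => f (serviceDistance x ω) *
      poissonLaplace lam (strictOuter ψ (serviceDistance x ω)))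
    (fun _ => (nndist f 0 : ℝ≥0))
    (fun n => (hfm n).mul (hcount n (fun b _ => poissonLaplace lam (outer ψ b)) fun b =>
      measurable_const))
    (fun n => ae_of_all _ fun ω => (mul_le_mul' (hbd _) (expNeg_le_one _)).trans (by simp))
    (by simp)
    (ae_of_all _ fun ω => ENNReal.Tendsto.mul (hflim ω) (Or.inr (expNeg_ne_top _))
      (tendsto_poissonLaplace_outer lam hψ (serviceDistance_nonneg x ω))
      (Or.inr ENNReal.coe_ne_top))
  exact tendsto_nhds_unique (hL.congr fun n =>
    lintegral_dyadicAbove_outer hx hψ (fun r => (f r : ℝ≥0∞)) n) hRt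

lemma measurable_pointSum_strictOuter (hx : ∀ k, Measurable (x k)) {ψ : Plane → ℝ≥0∞}
    (hψ : Measurable ψ) :
    Measurable fun ω => pointSum x (strictOuter ψ (serviceDistance x ω)) ω := by
  refine Measurable.tsum fun k => ?_
  have : (fun ω => strictOuter ψ (serviceDistance x ω) (x k ω)) =
      {ω | serviceDistance x ω < ‖x k ω‖}.indicator fun ω => ψ (x k ω) := by
    funext ω
    rw [strictOuter_apply]; rfl
  rw [this]
  exact (hψ.comp (hx k)).indicator
    (measurableSet_lt (measurable_serviceDistance hx) (hx k).norm)

lemma measurable_poissonLaplace_strictOuter (lam : ℝ) {ψ : Plane → ℝ≥0∞} (hψ : Measurable ψ) :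
    Measurable fun r => poissonLaplace lam (strictOuter ψ r) := by
  have h : Measurable fun p : ℝ × Plane => strictOuter ψ p.1 p.2 := by
    have : (fun p : ℝ × Plane => strictOuter ψ p.1 p.2) =
        {p : ℝ × Plane | p.1 < ‖p.2‖}.indicator fun p => ψ p.2 := by
      funext p
      rw [strictOuter_apply]; rfl
    rw [this]
    exact (hψ.comp measurable_snd).indicator
      (measurableSet_lt measurable_fst measurable_snd.norm)
  exact measurable_expNeg.comp
    ((measurable_const.sub (measurable_expNeg.comp h)).lintegral_prod_right'.const_mul _)

/-- Given the distance `r` to the nearest point, the points at distance greater than `r` form a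
Poisson process of the same intensity on the exterior of the disc of radius `r`: their Laplace
functional, integrated over any event in terms of the distance to the nearest point. -/
theorem setLIntegral_strictOuter (hx : IsHomogeneousPPP x lam μ) {ψ : Plane → ℝ≥0∞}
    (hψ : Measurable ψ) {A : Set ℝ} (hA : MeasurableSet A) :
    ∫⁻ ω in serviceDistance x ⁻¹' A,
        expNeg (pointSum x (strictOuter ψ (serviceDistance x ω)) ω) ∂μ =
      ∫⁻ r in A, poissonLaplace lam (strictOuter ψ r) ∂(μ.map (serviceDistance x)) := by
  have hR := measurable_serviceDistance hx.measurable
  set X := fun ω => expNeg (pointSum x (strictOuter ψ (serviceDistance x ω)) ω) with hX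
  have hXm : Measurable X := measurable_expNeg.comp
    (measurable_pointSum_strictOuter hx.measurable hψ)
  have hGm := measurable_poissonLaplace_strictOuter lam hψ
  have := Measure.isProbabilityMeasure_map (μ := μ) hR.aemeasurable
  have hf1 : IsFiniteMeasure (μ.withDensity X) := isFiniteMeasure_withDensity
    ((lintegral_mono fun ω => expNeg_le_one _).trans_lt (by simp)).ne
  have key : (μ.withDensity X).map (serviceDistance x) =
      (μ.map (serviceDistance x)).withDensity fun r => poissonLaplace lam (strictOuter ψ r) := by
    refine ext_of_forall_lintegral_eq_of_IsFiniteMeasure fun f => ?_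
    have hf : Measurable fun r => (f r : ℝ≥0∞) := f.continuous.measurable.coe_nnreal_ennreal
    have hfR : Measurable fun ω => (f (serviceDistance x ω) : ℝ≥0∞) := hf.comp hR
    rw [lintegral_map hf hR, lintegral_withDensity_eq_lintegral_mul _ hXm hfR,
      lintegral_withDensity_eq_lintegral_mul _ hGm hf, lintegral_map (hGm.mul hf) hR]
    simp only [Pi.mul_apply]
    simp_rw [mul_comm (X _), mul_comm (poissonLaplace _ _)]
    exact lintegral_strictOuter hx hψ f
  have := congrArg (fun ν => ν A) key
  rwa [Measure.map_apply hR hA, withDensity_apply _ (hR hA), withDensity_apply _ hA] at this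

end

end

/-! ### Euler's integral for the Gauss hypergeometric function -/

section

/-- Euler's integral `b ∫₀¹ s^{b-1} / (1 - t s) ds` for `₂F₁(1, b; b + 1; t)`. -/
noncomputable def eulerIntegral (b t : ℝ) : ℝ :=
  b * ∫ s in Set.Ioo (0 : ℝ) 1, s ^ (b - 1) / (1 - t * s)

/-- The Taylor coefficients of `eulerIntegral b` at `t₀`. -/
noncomputable def eulerCoeff (b t₀ : ℝ) (n : ℕ) : ℝ :=
  b * ∫ s in Set.Ioo (0 : ℝ) 1, s ^ (b - 1) / (1 - t₀ * s) * (s / (1 - t₀ * s)) ^ n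

lemma one_sub_mul_pos {t s : ℝ} (ht : t < 1) (hs : s ∈ Set.Ioo (0 : ℝ) 1) : 0 < 1 - t * s := by
  obtain ⟨h0, h1⟩ := hs
  nlinarith

/-- The bound behind the radius of convergence `1 - t₀`: the map `s ↦ s / (1 - t₀ s)` increases on
`(0, 1)`. -/
lemma div_one_sub_mul_le {t s : ℝ} (ht : t < 1) (hs : s ∈ Set.Ioo (0 : ℝ) 1) :
    s / (1 - t * s) ≤ 1 / (1 - t) := by
  rw [div_le_div_iff₀ (one_sub_mul_pos ht hs) (by linarith)]
  nlinarith [hs.1, hs.2]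

lemma integrableOn_rpow_sub_one {b : ℝ} (hb : 0 < b) :
    IntegrableOn (fun s : ℝ => s ^ (b - 1)) (Set.Ioo 0 1) :=
  (intervalIntegral.integrableOn_Ioo_rpow_iff one_pos).2 (by linarith)

lemma integrableOn_eulerIntegrand {b t : ℝ} (hb : 0 < b) (ht : t < 1) (n : ℕ) :
    IntegrableOn (fun s : ℝ => s ^ (b - 1) / (1 - t * s) * (s / (1 - t * s)) ^ n)
      (Set.Ioo 0 1) := by
  have hc : ContinuousOn (fun s : ℝ => (1 - t * s)⁻¹ * (s / (1 - t * s)) ^ n) (Set.Icc 0 1) := by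
    have hne : ∀ s ∈ Set.Icc (0 : ℝ) 1, 1 - t * s ≠ 0 := by
      intro s hs
      have : 0 < 1 - t * s := by
        rcases hs.2.lt_or_eq with h | h
        · rcases hs.1.lt_or_eq with h' | h'
          · exact one_sub_mul_pos ht ⟨h', h⟩
          · simp [← h']
        · simpa [h] using ht
      exact this.ne'
    exact ((continuousOn_const.sub (continuousOn_const.mul continuousOn_id)).inv₀ hne).mul
      ((continuousOn_id.div (continuousOn_const.sub (continuousOn_const.mul continuousOn_id))
        hne).pow n)
  have h1 : IntegrableOn (fun s : ℝ => s ^ (b - 1)) (Set.Icc 0 1) := by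
    rw [integrableOn_Icc_iff_integrableOn_Ioo]; exact integrableOn_rpow_sub_one hb
  have h2 := h1.mul_continuousOn hc isCompact_Icc
  refine (h2.mono_set Set.Ioo_subset_Icc_self).congr_fun (fun s _ => ?_) measurableSet_Ioo
  simp only [div_eq_mul_inv]; ring

lemma eulerCoeff_bound {b t₀ : ℝ} (hb : 0 < b) (ht₀ : t₀ < 1) (n : ℕ) :
    |eulerCoeff b t₀ n| ≤ eulerIntegral b t₀ * (1 / (1 - t₀)) ^ n := by
  have h0 : ∀ s ∈ Set.Ioo (0 : ℝ) 1,
      0 ≤ s ^ (b - 1) / (1 - t₀ * s) * (s / (1 - t₀ * s)) ^ n := fun s hs => by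
    have := one_sub_mul_pos ht₀ hs
    have := hs.1
    positivity
  rw [eulerCoeff, abs_of_nonneg (mul_nonneg hb.le (setIntegral_nonneg measurableSet_Ioo h0)),
    eulerIntegral, mul_assoc, ← integral_mul_const]
  refine mul_le_mul_of_nonneg_left ?_ hb.le
  refine setIntegral_mono_on (integrableOn_eulerIntegrand hb ht₀ n) ?_ measurableSet_Ioo
    fun s hs => ?_
  · have := integrableOn_eulerIntegrand hb ht₀ 0
    simp only [pow_zero, mul_one] at this
    exact this.mul_const _
  · have h1 := one_sub_mul_pos ht₀ hs
    have h2 := hs.1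
    exact mul_le_mul_of_nonneg_left
      (pow_le_pow_left₀ (by positivity) (div_one_sub_mul_le ht₀ hs) n) (by positivity)

lemma hasSum_eulerCoeff {b t₀ y : ℝ} (hb : 0 < b) (ht₀ : t₀ < 1) (hy : |y| < 1 - t₀) :
    HasSum (fun n => y ^ n * eulerCoeff b t₀ n) (eulerIntegral b (t₀ + y)) := by
  set F : ℕ → ℝ → ℝ := fun n s =>
    y ^ n * (s ^ (b - 1) / (1 - t₀ * s) * (s / (1 - t₀ * s)) ^ n) with hF
  have hint : ∀ n, IntegrableOn (F n) (Set.Ioo 0 1) := fun n =>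
    (integrableOn_eulerIntegrand hb ht₀ n).const_mul _
  have hq : |y| * (1 / (1 - t₀)) < 1 := by
    rw [mul_one_div, div_lt_one (by linarith)]; exact hy
  have hnorm : ∀ n, ∫ s in Set.Ioo (0 : ℝ) 1, ‖F n s‖ =
      |y| ^ n * ∫ s in Set.Ioo (0 : ℝ) 1,
        s ^ (b - 1) / (1 - t₀ * s) * (s / (1 - t₀ * s)) ^ n := by
    intro n
    rw [← integral_const_mul]
    refine setIntegral_congr_fun measurableSet_Ioo fun s hs => ?_
    have h1 := one_sub_mul_pos ht₀ hs
    have h2 := hs.1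
    simp only [hF]
    rw [norm_mul, norm_pow, Real.norm_eq_abs, Real.norm_of_nonneg (by positivity)]
  have hsum : Summable fun n => ∫ s in Set.Ioo (0 : ℝ) 1, ‖F n s‖ := by
    refine Summable.of_nonneg_of_le (fun n => integral_nonneg fun s => norm_nonneg _) (fun n => ?_)
      ((summable_geometric_of_lt_one (by have := sub_pos.2 ht₀; positivity) hq).mul_left
        (b⁻¹ * eulerIntegral b t₀))
    have := (le_abs_self _).trans (eulerCoeff_bound hb ht₀ n)
    rw [eulerCoeff, ← le_div_iff₀' hb] at this
    rw [hnorm, mul_pow]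
    refine (mul_le_mul_of_nonneg_left this (by positivity)).trans (le_of_eq ?_)
    field_simp
  have h := hasSum_integral_of_summable_integral_norm hint hsum
  have hpt : ∀ s ∈ Set.Ioo (0 : ℝ) 1, ∑' n, F n s = s ^ (b - 1) / (1 - (t₀ + y) * s) := by
    intro s hs
    have h1 := one_sub_mul_pos ht₀ hs
    have h2 := hs.1
    have hlt : |y * (s / (1 - t₀ * s))| < 1 := by
      rw [abs_mul, abs_of_nonneg (show 0 ≤ s / (1 - t₀ * s) by positivity)]
      exact (mul_le_mul_of_nonneg_left (div_one_sub_mul_le ht₀ hs) (abs_nonneg y)).trans_lt hq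
    have : ∀ n, F n s = s ^ (b - 1) / (1 - t₀ * s) * (y * (s / (1 - t₀ * s))) ^ n := fun n => by
      simp only [hF, mul_pow]; ring
    simp_rw [this]
    rw [tsum_mul_left, tsum_geometric_of_abs_lt_one hlt]
    have h3 : 1 - (t₀ + y) * s ≠ 0 :=
      (one_sub_mul_pos (by linarith [le_abs_self y]) hs).ne'
    have h4 : 1 - y * (s / (1 - t₀ * s)) = (1 - (t₀ + y) * s) / (1 - t₀ * s) := by
      have := h1.ne'
      rw [eq_div_iff this, sub_mul, mul_assoc, div_mul_cancel₀ _ this]; ring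
    rw [h4]
    field_simp
  rw [setIntegral_congr_fun measurableSet_Ioo hpt] at h
  have hc : (fun n => y ^ n * eulerCoeff b t₀ n) =
      fun n => b * ∫ s in Set.Ioo (0 : ℝ) 1, F n s := by
    funext n
    rw [eulerCoeff, integral_const_mul]; ring
  rw [hc]
  exact h.mul_left b

lemma analyticAt_eulerIntegral {b t₀ : ℝ} (hb : 0 < b) (ht₀ : t₀ < 1) :
    AnalyticAt ℝ (eulerIntegral b) t₀ := by
  have hpos : 0 < 1 - t₀ := sub_pos.2 ht₀
  have h : HasFPowerSeriesOnBall (eulerIntegral b)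
      (FormalMultilinearSeries.ofScalars ℝ (eulerCoeff b t₀)) t₀ (ENNReal.ofReal (1 - t₀)) := by
    refine ⟨?_, by simpa using ht₀, fun {y} hy => ?_⟩
    · refine FormalMultilinearSeries.le_radius_of_bound _ (eulerIntegral b t₀) fun n => ?_
      rw [FormalMultilinearSeries.ofScalars_norm, Real.norm_eq_abs]
      refine (mul_le_mul_of_nonneg_right (eulerCoeff_bound hb ht₀ n) (by positivity)).trans
        (le_of_eq ?_)
      rw [mul_assoc, ← mul_pow, Real.coe_toNNReal _ hpos.le, one_div_mul_cancel hpos.ne', one_pow,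
        mul_one]
    · have hy' : |y| < 1 - t₀ := by
        rw [Metric.mem_eball, edist_dist, ENNReal.ofReal_lt_ofReal_iff hpos] at hy
        simpa using hy
      simp_rw [FormalMultilinearSeries.ofScalars_apply_eq, smul_eq_mul, mul_comm _ (y ^ _)]
      exact hasSum_eulerCoeff hb ht₀ hy'
  exact h.analyticAt

lemma eulerCoeff_zero {b : ℝ} (hb : 0 < b) (n : ℕ) : eulerCoeff b 0 n = b / (b + n) := by
  have h : ∀ s ∈ Set.Ioo (0 : ℝ) 1,
      s ^ (b - 1) / (1 - 0 * s) * (s / (1 - 0 * s)) ^ n = s ^ (b - 1 + n) := by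
    intro s hs
    rw [Real.rpow_add_natCast hs.1.ne']; simp
  rw [eulerCoeff, setIntegral_congr_fun measurableSet_Ioo h, ← integral_Ioc_eq_integral_Ioo,
    ← intervalIntegral.integral_of_le zero_le_one,
    integral_rpow (Or.inl (by have := n.cast_nonneg (α := ℝ); linarith))]
  have : b - 1 + n + 1 = b + n := by ring
  have hbn : b + n ≠ 0 := by positivity
  rw [this, Real.one_rpow, Real.zero_rpow hbn, sub_zero, mul_one_div]

lemma ordinaryHypergeometric_one_eq_eulerIntegral {b t : ℝ} (hb : 0 < b) (ht : |t| < 1) :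
    ordinaryHypergeometric 1 b (b + 1) t = eulerIntegral b t := by
  have h := hasSum_eulerCoeff hb zero_lt_one (y := t) (by simpa using ht)
  rw [zero_add] at h
  rw [← h.tsum_eq, ordinaryHypergeometric_eq_tsum]
  refine tsum_congr fun n => ?_
  have h1 : (ascPochhammer ℝ n).eval b * (b + n) = b * (ascPochhammer ℝ n).eval (b + 1) := by
    have h2 := congrArg (Polynomial.eval b) (ascPochhammer_succ_left ℝ n)
    rw [ascPochhammer_succ_right] at h2
    simpa using h2
  have h3 : (ascPochhammer ℝ n).eval (b + 1) ≠ 0 := (ascPochhammer_pos n _ (by linarith)).ne'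
  have h4 : (n.factorial : ℝ) ≠ 0 := by exact_mod_cast n.factorial_ne_zero
  have h5 : b + n ≠ 0 := by positivity
  rw [eulerCoeff_zero hb, ascPochhammer_eval_one, inv_mul_cancel₀ h4, one_mul, smul_eq_mul,
    mul_comm, ← div_eq_mul_inv, (div_eq_div_iff h3 h5).2 h1]

lemma isGaussContinuation_eulerIntegral {b : ℝ} (hb : 0 < b) :
    IsGaussContinuation 1 b (b + 1) (eulerIntegral b) :=
  ⟨fun _ ht => analyticAt_eulerIntegral hb ht, fun _ ht =>
    (ordinaryHypergeometric_one_eq_eulerIntegral hb ht).symm⟩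

lemma gauss2F1_one_eq_eulerIntegral {b t : ℝ} (hb : 0 < b) (ht : t < 1) :
    gauss2F1 1 b (b + 1) t = eulerIntegral b t :=
  gauss2F1_eq (isGaussContinuation_eulerIntegral hb) ht

/-- `₂F₁(1, 1/2; 3/2; -c²) = arctan c / c`, as `arctan (c √s)` is an antiderivative of `c` times
the integrand of Euler's integral (with its factor `1/2`). -/
lemma mul_eulerIntegral_half (c : ℝ) :
    c * eulerIntegral (1 / 2) (-c ^ 2) = Real.arctan c := by
  have hderiv : ∀ s ∈ Set.Ioo (0 : ℝ) 1, HasDerivAt (fun s => Real.arctan (c * Real.sqrt s))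
      (c * (1 / 2) * (s ^ ((1 / 2 : ℝ) - 1) / (1 - -c ^ 2 * s))) s := by
    intro s hs
    have h1 := ((Real.hasDerivAt_sqrt hs.1.ne').const_mul c).arctan
    convert h1 using 1
    have h2 : s ^ ((1 / 2 : ℝ) - 1) = (Real.sqrt s)⁻¹ := by
      rw [Real.sqrt_eq_rpow, ← Real.rpow_neg hs.1.le]; norm_num
    rw [h2, mul_pow, Real.sq_sqrt hs.1.le]
    have := Real.sqrt_pos.2 hs.1
    have h3 : 1 + c ^ 2 * s ≠ 0 := by have := hs.1; positivity
    have h4 : 1 - -c ^ 2 * s = 1 + c ^ 2 * s := by ring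
    rw [h4]
    field_simp
  have hi := integrableOn_eulerIntegrand (b := 1 / 2) (t := -c ^ 2) (by norm_num)
    (by nlinarith [sq_nonneg c]) 0
  simp only [pow_zero, mul_one] at hi
  have h := intervalIntegral.integral_eq_sub_of_hasDerivAt_of_le (a := 0) (b := 1) zero_le_one
    (f := fun s => Real.arctan (c * Real.sqrt s))
    (Real.continuous_arctan.comp (continuous_const.mul Real.continuous_sqrt)).continuousOn hderiv
    ((intervalIntegrable_iff_integrableOn_Ioo_of_le zero_le_one).2 (hi.const_mul _))
  rw [intervalIntegral.integral_of_le zero_le_one, integral_Ioc_eq_integral_Ioo,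
    integral_const_mul] at h
  rw [eulerIntegral, ← mul_assoc, h]
  simp

end

/-! ### The exponent of the Laplace transform in closed form -/

section

/-- The function `y ↦ log (1 + w ‖y‖^{-η})`: what remains, in the exponent, of the contribution of
an interferer at `y` once its Rayleigh fading has been averaged out. -/
noncomputable def fadedPathLoss (w η : ℝ) (y : Plane) : ℝ≥0∞ :=
  ENNReal.ofReal (Real.log (1 + w * ‖y‖ ^ (-η)))

lemma measurable_fadedPathLoss (w η : ℝ) : Measurable (fadedPathLoss w η) :=
  (Real.measurable_log.comp
    (((measurable_norm.pow_const (-η)).const_mul w).const_add 1)).ennreal_ofReal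

/-- The radial profile of `1 - exp (-fadedPathLoss)` outside the disc of radius `r`. -/
noncomputable def thinning (w η r : ℝ) : ℝ → ℝ :=
  (Set.Ioi r).indicator fun s => w * s ^ (-η) / (1 + w * s ^ (-η))

lemma one_sub_expNeg_strictOuter {w : ℝ} (hw : 0 ≤ w) (η r : ℝ) (y : Plane) :
    1 - expNeg (strictOuter (fadedPathLoss w η) r y) = ENNReal.ofReal (thinning w η r ‖y‖) := by
  rw [strictOuter_apply]
  by_cases h : r < ‖y‖
  · have hp : 0 ≤ w * ‖y‖ ^ (-η) := by positivity
    have hlog := Real.log_nonneg (show 1 ≤ 1 + w * ‖y‖ ^ (-η) by linarith)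
    rw [if_pos h, thinning, Set.indicator_of_mem (Set.mem_Ioi.2 h), fadedPathLoss,
      expNeg_ofReal hlog, ← ENNReal.ofReal_one, ← ENNReal.ofReal_sub _ (Real.exp_pos _).le,
      Real.exp_neg, Real.exp_log (by linarith)]
    congr 1
    field_simp
    ring
  · rw [if_neg h, thinning, Set.indicator_of_notMem (by simpa using h)]
    simp

lemma thinning_nonneg {w : ℝ} (hw : 0 ≤ w) (η : ℝ) {r : ℝ} (hr : 0 < r) (s : ℝ) :
    0 ≤ thinning w η r s := by
  refine Set.indicator_nonneg (fun s hs => ?_) s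
  have : 0 < s := hr.trans hs
  positivity

lemma measurable_thinning (w η r : ℝ) : Measurable (thinning w η r) := by
  refine Measurable.indicator ?_ measurableSet_Ioi
  have : Measurable fun s : ℝ => w * s ^ (-η) := (measurable_id.pow_const (-η)).const_mul w
  exact this.div (this.const_add 1)

lemma integrableOn_mul_thinning {w η r : ℝ} (hw : 0 ≤ w) (hη : 2 < η) (hr : 0 < r) :
    IntegrableOn (fun s => s * thinning w η r s) (Set.Ioi 0) := by
  have h1 : IntegrableOn (fun s : ℝ => w * s ^ (1 - η)) (Set.Ioi r) :=
    (integrableOn_Ioi_rpow_of_lt (by linarith) hr).const_mul w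
  have h2 : Integrable ((Set.Ioi r).indicator fun s : ℝ => w * s ^ (1 - η)) :=
    (integrable_indicator_iff measurableSet_Ioi).2 h1
  refine Integrable.mono' h2.integrableOn
    (measurable_id.mul (measurable_thinning w η r)).aestronglyMeasurable ?_
  refine (ae_restrict_iff' measurableSet_Ioi).2 (ae_of_all _ fun s hs => ?_)
  rw [Real.norm_of_nonneg (mul_nonneg (le_of_lt hs) (thinning_nonneg hw η hr s))]
  by_cases h : s ∈ Set.Ioi r
  · have hs' : 0 < s := hs
    rw [thinning, Set.indicator_of_mem h, Set.indicator_of_mem h, sub_eq_add_neg,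
      Real.rpow_add hs', Real.rpow_one, mul_left_comm w]
    refine mul_le_mul_of_nonneg_left (div_le_self (by positivity) ?_) hs'.le
    have : 0 ≤ w * s ^ (-η) := by positivity
    linarith
  · rw [thinning, Set.indicator_of_notMem h, Set.indicator_of_notMem h, mul_zero]

/-- The substitution `s = r v^{-1/η}` turns the radial integral into Euler's integral. -/
lemma integral_mul_thinning {w η r : ℝ} (hη : 2 < η) (hr : 0 < r) :
    ∫ s in Set.Ioi (0 : ℝ), s * thinning w η r s =
      w * r ^ (2 - η) / (η - 2) * eulerIntegral (1 - 2 / η) (-(w / r ^ η)) := by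
  have hη0 : 0 < η := by linarith
  have h1 := integral_comp_mul_left_Ioi (fun s => s * thinning w η r s) 0 hr
  have h2 := integral_comp_rpow_Ioi (fun u => (r * u) * thinning w η r (r * u))
    (p := -(1 / η)) (neg_ne_zero.2 (by positivity))
  rw [mul_zero] at h1
  have h3 : ∀ v ∈ Set.Ioi (0 : ℝ),
      (|-(1 / η)| * v ^ (-(1 / η) - 1)) • ((r * v ^ (-(1 / η))) * thinning w η r (r * v ^ (-(1 / η))))
        = (Set.Ioo (0 : ℝ) 1).indicator (fun v => (w * r ^ (1 - η) / η) *
          (v ^ ((1 - 2 / η) - 1) / (1 - -(w / r ^ η) * v))) v := by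
    intro v hv
    have hv0 : 0 < v := hv
    by_cases hv1 : v < 1
    · have hmem : r * v ^ (-(1 / η)) ∈ Set.Ioi r := by
        have : 1 < v ^ (-(1 / η)) :=
          Real.one_lt_rpow_of_pos_of_lt_one_of_neg hv0 hv1 (neg_neg_of_pos (by positivity))
        rw [Set.mem_Ioi]
        nlinarith
      have e1 : (r * v ^ (-(1 / η))) ^ (-η) = (r ^ η)⁻¹ * v := by
        rw [Real.mul_rpow hr.le (by positivity), ← Real.rpow_mul hv0.le, Real.rpow_neg hr.le]
        have : -(1 / η) * -η = 1 := by field_simp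
        rw [this, Real.rpow_one]
      have e2 : v ^ ((1 - 2 / η) - 1) = v ^ (-(1 / η) - 1) * v ^ (-(1 / η)) * v := by
        have : (1 - 2 / η) - 1 = (-(1 / η) - 1) + -(1 / η) + 1 := by ring
        rw [this, Real.rpow_add hv0, Real.rpow_add hv0, Real.rpow_one]
      have e3 : r ^ (1 - η) = r * (r ^ η)⁻¹ := by
        rw [sub_eq_add_neg, Real.rpow_add hr, Real.rpow_one, Real.rpow_neg hr.le]
      rw [thinning, Set.indicator_of_mem hmem, Set.indicator_of_mem (Set.mem_Ioo.2 ⟨hv0, hv1⟩), e1,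
        e2, e3, abs_neg, abs_of_pos (by positivity), smul_eq_mul]
      have e4 : 1 - -(w / r ^ η) * v = 1 + w * ((r ^ η)⁻¹ * v) := by ring
      rw [e4]
      ring
    · have hnm : r * v ^ (-(1 / η)) ∉ Set.Ioi r := by
        have : v ^ (-(1 / η)) ≤ 1 := Real.rpow_le_one_of_one_le_of_nonpos (not_lt.1 hv1)
          (neg_nonpos.2 (by positivity))
        rw [Set.mem_Ioi, not_lt]
        nlinarith
      rw [thinning, Set.indicator_of_notMem hnm, Set.indicator_of_notMem (fun h => hv1 h.2)]
      simp
  rw [setIntegral_congr_fun measurableSet_Ioi h3, setIntegral_indicator measurableSet_Ioo,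
    Set.inter_eq_right.2 fun v hv => hv.1, integral_const_mul] at h2
  rw [← h2, smul_eq_mul, eq_inv_mul_iff_mul_eq₀ hr.ne'] at h1
  rw [← h1, eulerIntegral]
  have e5 : r ^ (2 - η) = r * r ^ (1 - η) := by
    rw [show (2 : ℝ) - η = 1 + (1 - η) by ring, Real.rpow_add hr, Real.rpow_one]
  rw [e5]
  have : η - 2 ≠ 0 := by linarith
  generalize (∫ v in Set.Ioo (0 : ℝ) 1, v ^ ((1 - 2 / η) - 1) / (1 - -(w / r ^ η) * v)) = K
  field_simp

/-- The exponent of the conditional Laplace transform. -/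
noncomputable def interferenceExponent (lam η w r : ℝ) : ℝ :=
  2 * Real.pi * lam * (w * r ^ (2 - η) / (η - 2) * eulerIntegral (1 - 2 / η) (-(w / r ^ η)))

lemma poissonLaplace_fadedPathLoss {lam w η r : ℝ} (hlam : 0 ≤ lam) (hw : 0 ≤ w) (hη : 2 < η)
    (hr : 0 < r) :
    poissonLaplace lam (strictOuter (fadedPathLoss w η) r) =
      ENNReal.ofReal (Real.exp (-interferenceExponent lam η w r)) := by
  have hdim : Module.finrank ℝ Plane = 2 := by simp
  have hball : (volume : Measure Plane).real (Metric.ball 0 1) = Real.pi := by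
    rw [measureReal_def, EuclideanSpace.volume_ball_fin_two]
    simp [Real.pi_pos.le]
  have hint : Integrable (fun y : Plane => thinning w η r ‖y‖) := by
    rw [integrable_fun_norm_addHaar, hdim]
    simpa using integrableOn_mul_thinning hw hη hr
  have hval : ∫ y : Plane, thinning w η r ‖y‖ =
      2 * Real.pi * (w * r ^ (2 - η) / (η - 2) * eulerIntegral (1 - 2 / η) (-(w / r ^ η))) := by
    rw [integral_fun_norm_addHaar, hdim, hball, ← integral_mul_thinning hη hr]
    simp [mul_assoc]
  have hn : 0 ≤ ∫ y : Plane, thinning w η r ‖y‖ :=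
    integral_nonneg fun y => thinning_nonneg hw η hr _
  rw [poissonLaplace, lintegral_congr (one_sub_expNeg_strictOuter hw η r),
    ← ofReal_integral_eq_lintegral_ofReal hint (ae_of_all _ fun y => thinning_nonneg hw η hr _),
    ← ENNReal.ofReal_mul hlam, expNeg_ofReal (mul_nonneg hlam hn), hval, interferenceExponent]
  congr 3; ring

lemma interferenceExponent_zero (lam η r : ℝ) : interferenceExponent lam η 0 r = 0 := by
  simp [interferenceExponent]

lemma continuousOn_interferenceExponent (lam : ℝ) {η r : ℝ} (hη : 2 < η) (hr : 0 < r) :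
    ContinuousOn (fun w => interferenceExponent lam η w r) (Set.Ici 0) := by
  have hb : 0 < 1 - 2 / η := by rw [sub_pos, div_lt_one] <;> linarith
  have h1 : ContinuousOn (eulerIntegral (1 - 2 / η)) (Set.Iio 1) := fun t ht =>
    (analyticAt_eulerIntegral hb ht).continuousAt.continuousWithinAt
  have h2 : ContinuousOn (fun w => eulerIntegral (1 - 2 / η) (-(w / r ^ η))) (Set.Ici 0) := by
    refine h1.comp (by fun_prop) fun w hw => ?_
    have : 0 ≤ w / r ^ η := div_nonneg hw (by positivity)
    rw [Set.mem_Iio]; linarith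
  exact continuousOn_const.mul ((by fun_prop : ContinuousOn (fun w : ℝ =>
    w * r ^ (2 - η) / (η - 2)) (Set.Ici 0)).mul h2)

lemma interferenceExponent_eq_gauss2F1 (lam P z : ℝ) {η r : ℝ} (hP : 0 ≤ P) (hz : 0 ≤ z)
    (hη : 2 < η) (hr : 0 < r) :
    interferenceExponent lam η (z * P) r = 2 * Real.pi * lam * z * P * r ^ (2 - η) / (η - 2) *
      gauss2F1 1 (1 - 2 / η) (2 - 2 / η) (-(z * P / r ^ η)) := by
  have hb : 0 < 1 - 2 / η := by rw [sub_pos, div_lt_one] <;> linarith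
  have ht : -(z * P / r ^ η) < 1 := by
    have : 0 ≤ z * P / r ^ η := by positivity
    linarith
  rw [show 2 - 2 / η = (1 - 2 / η) + 1 by ring, gauss2F1_one_eq_eulerIntegral hb ht,
    interferenceExponent]
  ring

lemma interferenceExponent_four (lam : ℝ) {w r : ℝ} (hw : 0 ≤ w) (hr : 0 < r) :
    interferenceExponent lam 4 w r =
      Real.pi * lam * Real.sqrt w * Real.arctan (Real.sqrt w / r ^ 2) := by
  have h := mul_eulerIntegral_half (Real.sqrt w / r ^ 2)
  have h1 : (Real.sqrt w / r ^ 2) ^ 2 = w / r ^ (4 : ℝ) := by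
    rw [div_pow, Real.sq_sqrt hw, show (4 : ℝ) = ((4 : ℕ) : ℝ) by norm_num, Real.rpow_natCast]
    ring
  have h2 : r ^ ((2 : ℝ) - 4) = (r ^ 2)⁻¹ := by
    rw [show (2 : ℝ) - 4 = -((2 : ℕ) : ℝ) by norm_num, Real.rpow_neg hr.le, Real.rpow_natCast]
  rw [h1] at h
  rw [← h, interferenceExponent, h2, show (1 : ℝ) - 2 / 4 = 1 / 2 by norm_num]
  have h3 := Real.mul_self_sqrt hw
  generalize eulerIntegral (1 / 2) (-(w / r ^ (4 : ℝ))) = E at *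
  generalize Real.sqrt w = q at *
  rw [← h3]
  ring

end

/-! ### The aggregate interference -/

section

/-- The aggregate interference power as a sum in `[0, ∞]`, where no convergence is needed. -/
noncomputable def extInterference {Ω : Type*} (x : ℕ → Ω → Plane) (h : ℕ → Ω → ℂ) (P η : ℝ)
    (ω : Ω) : ℝ≥0∞ :=
  ∑' k, ENNReal.ofReal (interferenceTerm x h P η k ω)

lemma interferenceTerm_nonneg {Ω : Type*} (x : ℕ → Ω → Plane) (h : ℕ → Ω → ℂ) {P : ℝ}
    (hP : 0 ≤ P) (η : ℝ) (k : ℕ) (ω : Ω) : 0 ≤ interferenceTerm x h P η k ω := by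
  unfold interferenceTerm
  split_ifs
  · exact le_rfl
  · positivity

lemma aggregateInterference_nonneg {Ω : Type*} (x : ℕ → Ω → Plane) (h : ℕ → Ω → ℂ) {P : ℝ}
    (hP : 0 ≤ P) (η : ℝ) (ω : Ω) : 0 ≤ aggregateInterference x h P η ω :=
  tsum_nonneg fun k => interferenceTerm_nonneg x h hP η k ω

lemma summable_interferenceTerm {Ω : Type*} {x : ℕ → Ω → Plane} {h : ℕ → Ω → ℂ} {P : ℝ}
    (hP : 0 ≤ P) {η : ℝ} {ω : Ω} (hfin : extInterference x h P η ω ≠ ∞) :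
    Summable fun k => interferenceTerm x h P η k ω :=
  (ENNReal.summable_toReal hfin).congr fun k =>
    ENNReal.toReal_ofReal (interferenceTerm_nonneg x h hP η k ω)

lemma expNeg_mul_extInterference {Ω : Type*} {x : ℕ → Ω → Plane} {h : ℕ → Ω → ℂ} {P z : ℝ}
    (hP : 0 ≤ P) (hz : 0 ≤ z) {η : ℝ} {ω : Ω} (hfin : extInterference x h P η ω ≠ ∞) :
    expNeg (ENNReal.ofReal z * extInterference x h P η ω) =
      ENNReal.ofReal (Real.exp (-z * aggregateInterference x h P η ω)) := by
  have h1 : extInterference x h P η ω = ENNReal.ofReal (aggregateInterference x h P η ω) :=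
    (ENNReal.ofReal_tsum_of_nonneg (fun k => interferenceTerm_nonneg x h hP η k ω)
      (summable_interferenceTerm hP hfin)).symm
  rw [h1, ← ENNReal.ofReal_mul hz,
    expNeg_ofReal (mul_nonneg hz (aggregateInterference_nonneg x h hP η ω)), neg_mul]

variable {Ω : Type*} [MeasurableSpace Ω] {x : ℕ → Ω → Plane} {h : ℕ → Ω → ℂ} {lam : ℝ}
  {μ : Measure Ω}

lemma measurable_interferenceTerm (P η : ℝ) (hx : ∀ k, Measurable (x k))
    (hh : ∀ k, Measurable (h k)) (k : ℕ) : Measurable (interferenceTerm x h P η k) := by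
  classical
  exact Measurable.ite (measurableSet_eq_fun (hx k).norm (measurable_serviceDistance hx))
    measurable_const ((((hh k).norm.pow_const 2).const_mul P).mul ((hx k).norm.pow_const (-η)))

lemma measurable_extInterference (P η : ℝ) (hx : ∀ k, Measurable (x k))
    (hh : ∀ k, Measurable (h k)) : Measurable (extInterference x h P η) :=
  Measurable.tsum fun k => (measurable_interferenceTerm P η hx hh k).ennreal_ofReal

variable [IsProbabilityMeasure μ]

/-- Averaging out the fading, on an event in terms of the service distance. -/
lemma setLIntegral_expNeg_extInterference_fading (hx : ∀ k, Measurable (x k))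
    (hh : IsRayleighFading h x μ) {P z : ℝ} (hP : 0 ≤ P) (hz : 0 ≤ z) (η : ℝ)
    {A : Set ℝ} (hA : MeasurableSet A) :
    ∫⁻ ω in serviceDistance x ⁻¹' A, expNeg (ENNReal.ofReal z * extInterference x h P η ω) ∂μ =
      ∫⁻ ω in serviceDistance x ⁻¹' A,
        expNeg (pointSum x (strictOuter (fadedPathLoss (z * P) η) (serviceDistance x ω)) ω) ∂μ := by
  classical
  let D : (ℕ → Plane) → ℝ := fun s => ⨅ k, ‖s k‖
  have hD : Measurable D := Measurable.iInf fun k => (measurable_pi_apply k).norm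
  let F : (ℕ → Plane) → ℝ≥0∞ := (D ⁻¹' A).indicator fun _ => 1
  have hF : Measurable F := measurable_const.indicator (hD hA)
  let W : ℕ → (ℕ → Plane) → ℝ := fun k s =>
    if ‖s k‖ = D s then 0 else z * P * ‖s k‖ ^ (-η)
  have hWm : ∀ k, Measurable (W k) := fun k =>
    Measurable.ite (measurableSet_eq_fun (measurable_pi_apply k).norm hD) measurable_const
      (((measurable_pi_apply k).norm.pow_const (-η)).const_mul _)
  have hW : ∀ k s, 0 ≤ W k s := by
    intro k s
    simp only [W]
    split_ifs
    · exact le_rfl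
    · positivity
  have hFX : ∀ (Y : Ω → ℝ≥0∞), ∫⁻ ω, F (fun k => x k ω) * Y ω ∂μ =
      ∫⁻ ω in serviceDistance x ⁻¹' A, Y ω ∂μ := by
    intro Y
    rw [← lintegral_indicator (measurable_serviceDistance hx hA)]
    refine lintegral_congr fun ω => ?_
    by_cases hω : serviceDistance x ω ∈ A
    · have h1 : F (fun k => x k ω) = 1 := Set.indicator_of_mem (by exact hω) _
      rw [h1, one_mul, Set.indicator_of_mem (by exact hω)]
    · have h1 : F (fun k => x k ω) = 0 := Set.indicator_of_notMem (by exact hω) _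
      rw [h1, zero_mul, Set.indicator_of_notMem (by exact hω)]
  have h1 : ∀ ω, ENNReal.ofReal z * extInterference x h P η ω =
      ∑' k, ENNReal.ofReal (W k (fun k => x k ω) * ‖h k ω‖ ^ 2) := by
    intro ω
    rw [extInterference, ← ENNReal.tsum_mul_left]
    refine tsum_congr fun k => ?_
    rw [← ENNReal.ofReal_mul hz]
    congr 1
    change z * (if ‖x k ω‖ = serviceDistance x ω then 0 else _) =
      (if ‖x k ω‖ = serviceDistance x ω then 0 else _) * _
    split_ifs
    · ring
    · ring
  have h2 : ∀ ω, pointSum x (strictOuter (fadedPathLoss (z * P) η) (serviceDistance x ω)) ω =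
      ∑' k, ENNReal.ofReal (Real.log (1 + W k (fun k => x k ω))) := by
    intro ω
    refine tsum_congr fun k => ?_
    change _ = ENNReal.ofReal (Real.log (1 + if ‖x k ω‖ = serviceDistance x ω then 0 else _))
    rw [strictOuter_apply]
    rcases (serviceDistance_le x ω k).eq_or_lt with h' | h'
    · rw [if_neg h'.not_lt, if_pos h'.symm]; simp
    · rw [if_pos h', if_neg h'.ne', fadedPathLoss]
  simp_rw [h1, h2]
  rw [← hFX, ← hFX]
  exact lintegral_mul_expNeg_fading hh hx hF hWm hW

/-- Almost surely there is no base station at the origin, nor do base stations accumulate there: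
the void probability of a disc tends to `1` as the disc shrinks. -/
lemma ae_serviceDistance_pos (hx : IsHomogeneousPPP x lam μ) :
    ∀ᵐ ω ∂μ, 0 < serviceDistance x ω := by
  have hR := measurable_serviceDistance hx.measurable
  have hm : MeasurableSet {ω | 0 < serviceDistance x ω} := measurableSet_lt measurable_const hR
  refine (mem_ae_iff_prob_eq_one hm).2 ?_
  refine le_antisymm prob_le_one ?_
  have hlim : Tendsto (fun n : ℕ => expNeg (ENNReal.ofReal lam *
      volume (Metric.ball (0 : Plane) (1 / ((n : ℝ) + 1))))) atTop (𝓝 1) := by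
    have h0 : Tendsto (fun n : ℕ => volume (Metric.ball (0 : Plane) (1 / ((n : ℝ) + 1)))) atTop
        (𝓝 0) := by
      simp_rw [EuclideanSpace.volume_ball_fin_two]
      have h1 := (ENNReal.tendsto_ofReal (tendsto_one_div_add_atTop_nhds_zero_nat (𝕜 := ℝ)))
      have h2 := ENNReal.Tendsto.mul_const (b := ENNReal.ofReal Real.pi)
        (ENNReal.Tendsto.pow (n := 2) h1) (Or.inr ENNReal.ofReal_ne_top)
      simpa using h2
    have h1 := ENNReal.Tendsto.const_mul (a := ENNReal.ofReal lam) h0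
      (Or.inr ENNReal.ofReal_ne_top)
    have h2 := (continuous_expNeg.tendsto _).comp h1
    simpa [Function.comp_def] using h2
  refine le_of_tendsto hlim (Eventually.of_forall fun n => ?_)
  rw [← measure_le_serviceDistance hx]
  refine measure_mono fun ω hω => ?_
  have hω' : 1 / ((n : ℝ) + 1) ≤ serviceDistance x ω := hω
  exact lt_of_lt_of_le (by positivity) hω'

lemma ae_map_serviceDistance_pos (hx : IsHomogeneousPPP x lam μ) :
    ∀ᵐ r ∂(μ.map (serviceDistance x)), 0 < r :=
  (ae_map_iff (measurable_serviceDistance hx.measurable).aemeasurable measurableSet_Ioi).2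
    (ae_serviceDistance_pos hx)

lemma setLIntegral_expNeg_extInterference (hx : IsHomogeneousPPP x lam μ)
    (hh : IsRayleighFading h x μ) {P z η : ℝ} (hlam : 0 ≤ lam) (hP : 0 ≤ P) (hz : 0 ≤ z)
    (hη : 2 < η) {A : Set ℝ} (hA : MeasurableSet A) :
    ∫⁻ ω in serviceDistance x ⁻¹' A, expNeg (ENNReal.ofReal z * extInterference x h P η ω) ∂μ =
      ∫⁻ r in A, ENNReal.ofReal (Real.exp (-interferenceExponent lam η (z * P) r))
        ∂(μ.map (serviceDistance x)) := by
  rw [setLIntegral_expNeg_extInterference_fading hx.measurable hh hP hz η hA,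
    setLIntegral_strictOuter hx (measurable_fadedPathLoss _ _) hA]
  refine lintegral_congr_ae (ae_restrict_of_ae ?_)
  filter_upwards [ae_map_serviceDistance_pos hx] with r hr
  exact poissonLaplace_fadedPathLoss hlam (mul_nonneg hz hP) hη hr

/-- Since `expNeg (z * ∞) = 0` for `z > 0`, the limit of the Laplace transform as `z ↓ 0` is a
lower bound of the probability that the interference is finite. -/
lemma ae_extInterference_ne_top (hx : IsHomogeneousPPP x lam μ)
    (hh : IsRayleighFading h x μ) {P η : ℝ} (hlam : 0 ≤ lam) (hP : 0 ≤ P) (hη : 2 < η) :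
    ∀ᵐ ω ∂μ, extInterference x h P η ω ≠ ∞ := by
  have hR := measurable_serviceDistance hx.measurable
  have hI := measurable_extInterference P η hx.measurable hh.measurable
  have hm : MeasurableSet {ω | extInterference x h P η ω ≠ ∞} :=
    hI (measurableSet_singleton ∞).compl
  have := Measure.isProbabilityMeasure_map (μ := μ) hR.aemeasurable
  let z : ℕ → ℝ := fun n => 1 / ((n : ℝ) + 1)
  have hz0 : ∀ n, 0 < z n := fun n => by positivity
  have hzlim : Tendsto z atTop (𝓝 0) := tendsto_one_div_add_atTop_nhds_zero_nat
  have hmL : ∀ n, AEMeasurable (fun r => ENNReal.ofReal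
      (Real.exp (-interferenceExponent lam η (z n * P) r))) (μ.map (serviceDistance x)) := by
    intro n
    refine (measurable_poissonLaplace_strictOuter lam
      (measurable_fadedPathLoss (z n * P) η)).aemeasurable.congr ?_
    filter_upwards [ae_map_serviceDistance_pos hx] with r hr
    exact poissonLaplace_fadedPathLoss hlam (mul_nonneg (hz0 n).le hP) hη hr
  have hlim : Tendsto (fun n => ∫⁻ r, ENNReal.ofReal
      (Real.exp (-interferenceExponent lam η (z n * P) r)) ∂(μ.map (serviceDistance x))) atTop
      (𝓝 1) := by
    have h1 : ∫⁻ _, 1 ∂(μ.map (serviceDistance x)) = 1 := by simp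
    rw [← h1]
    refine tendsto_lintegral_of_dominated_convergence' (fun _ => 1) hmL (fun n => ?_) (by simp) ?_
    · filter_upwards [ae_map_serviceDistance_pos hx] with r hr
      rw [← poissonLaplace_fadedPathLoss hlam (mul_nonneg (hz0 n).le hP) hη hr]
      exact expNeg_le_one _
    · filter_upwards [ae_map_serviceDistance_pos hx] with r hr
      have hc := continuousOn_interferenceExponent lam hη hr 0 Set.self_mem_Ici
      have hw : Tendsto (fun n => z n * P) atTop (𝓝[Set.Ici 0] 0) := by
        refine tendsto_nhdsWithin_iff.2 ⟨by simpa using hzlim.mul_const P, ?_⟩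
        exact Eventually.of_forall fun n => mul_nonneg (hz0 n).le hP
      have h2 := hc.tendsto.comp hw
      rw [interferenceExponent_zero] at h2
      have h3 := ENNReal.tendsto_ofReal ((Real.continuous_exp.tendsto _).comp h2.neg)
      simpa using h3
  refine (mem_ae_iff_prob_eq_one hm).2 ?_
  refine le_antisymm prob_le_one (le_of_tendsto hlim (Eventually.of_forall fun n => ?_))
  have h4 := setLIntegral_expNeg_extInterference hx hh hlam hP (hz0 n).le hη MeasurableSet.univ
  rw [Set.preimage_univ, setLIntegral_univ, setLIntegral_univ] at h4
  rw [← h4, ← lintegral_indicator_one hm]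
  refine lintegral_mono fun ω => ?_
  by_cases hω : extInterference x h P η ω = ∞
  · rw [hω, ENNReal.mul_top (by simpa using hz0 n), expNeg_top]
    exact zero_le
  · rw [Set.indicator_of_mem (by exact hω)]
    exact expNeg_le_one _

/-! ### The conditional Laplace transform -/

/-- A regular conditional Laplace transform of a non-negative variable is determined, for almost
every `r` and all `z ≥ 0` at once, by its integrals over events in terms of the conditioning
variable: both sides are continuous in `z`, so it suffices to compare them at rational `z`. -/
lemma condLaplace_ae_eq {X R : Ω → ℝ} (hX : Measurable X) (hR : Measurable R)
    (hX0 : ∀ᵐ ω ∂μ, 0 ≤ X ω) {Λ : ℝ → ℝ → ℝ}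
    (hΛ0 : ∀ z r, 0 ≤ Λ z r)
    (hΛm : ∀ z, 0 ≤ z → AEMeasurable (Λ z) (μ.map R))
    (hΛc : ∀ᵐ r ∂(μ.map R), ContinuousOn (fun z => Λ z r) (Set.Ici 0))
    (heq : ∀ z, 0 ≤ z → ∀ A, MeasurableSet A →
      ∫⁻ ω in R ⁻¹' A, ENNReal.ofReal (Real.exp (-z * X ω)) ∂μ =
        ∫⁻ r in A, ENNReal.ofReal (Λ z r) ∂(μ.map R)) :
    ∀ᵐ r ∂(μ.map R), ∀ z, 0 ≤ z → condLaplace μ X R r z = Λ z r := by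
  have := Measure.isProbabilityMeasure_map (μ := μ) hR.aemeasurable
  have hcomp : (μ.map R) ⊗ₘ condDistrib X R μ = μ.map fun ω => (R ω, X ω) :=
    compProd_map_condDistrib hX.aemeasurable
  have hcd0 : ∀ᵐ r ∂(μ.map R), ∀ᵐ y ∂(condDistrib X R μ r), 0 ≤ y := by
    have h1 : ∀ᵐ p ∂((μ.map R) ⊗ₘ condDistrib X R μ), 0 ≤ p.2 := by
      rw [hcomp, ae_map_iff (hR.prodMk hX).aemeasurable
        (measurableSet_le measurable_const measurable_snd)]
      exact hX0
    exact Measure.ae_ae_of_ae_compProd h1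
  have hz : ∀ z, 0 ≤ z → ∀ᵐ r ∂(μ.map R), condLaplace μ X R r z = Λ z r := by
    intro z hz
    have hem : Measurable fun y : ℝ => ENNReal.ofReal (Real.exp (-z * y)) := by fun_prop
    have hem2 : Measurable fun p : ℝ × ℝ => ENNReal.ofReal (Real.exp (-z * p.2)) := by fun_prop
    have h1 : (fun r => ∫⁻ y, ENNReal.ofReal (Real.exp (-z * y)) ∂(condDistrib X R μ r))
        =ᵐ[μ.map R] fun r => ENNReal.ofReal (Λ z r) := by
      refine ae_eq_of_forall_setLIntegral_eq_of_sigmaFinite₀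
        hem.lintegral_kernel.aemeasurable (hΛm z hz).ennreal_ofReal fun A hA _ => ?_
      rw [← heq z hz A hA]
      have h2 := Measure.setLIntegral_compProd (μ := μ.map R) (κ := condDistrib X R μ) hem2 hA
        MeasurableSet.univ
      simp only [Measure.restrict_univ] at h2
      rw [← h2, hcomp, setLIntegral_map (hA.prod MeasurableSet.univ) hem2 (hR.prodMk hX)]
      congr 2
      ext ω
      simp
    filter_upwards [h1] with r hr
    rw [condLaplace, integral_eq_lintegral_of_nonneg_ae (ae_of_all _ fun y => (Real.exp_pos _).le)
      (by fun_prop), hr, ENNReal.toReal_ofReal (hΛ0 z r)]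
  have hq : ∀ᵐ r ∂(μ.map R), ∀ q : ℚ, 0 ≤ (q : ℝ) → condLaplace μ X R r q = Λ q r := by
    rw [ae_all_iff]
    intro q
    by_cases h : 0 ≤ (q : ℝ)
    · filter_upwards [hz q h] with r hr _ using hr
    · exact ae_of_all _ fun r h' => absurd h' h
  filter_upwards [hq, hcd0, hΛc] with r hr h0 hc
  have hcl : ContinuousOn (fun z => condLaplace μ X R r z) (Set.Ici 0) := by
    refine continuousOn_of_dominated (bound := fun _ => 1) (fun z _ => by fun_prop)
      (fun z hz => ?_) (integrable_const _) (ae_of_all _ fun y => by fun_prop)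
    filter_upwards [h0] with y hy
    rw [Real.norm_eq_abs, Real.abs_exp, Real.exp_le_one_iff]
    have := mul_nonneg (Set.mem_Ici.1 hz) hy
    linarith
  have hsub : Set.Ioi (0 : ℝ) ∩ Set.range ((↑) : ℚ → ℝ) ⊆ Set.Ici 0 := fun z hz =>
    Set.mem_Ici.2 (le_of_lt hz.1)
  have hden : Set.Ici (0 : ℝ) ⊆ closure (Set.Ioi (0 : ℝ) ∩ Set.range ((↑) : ℚ → ℝ)) := by
    have h1 := (Rat.denseRange_cast (𝕜 := ℝ)).open_subset_closure_inter (isOpen_Ioi (a := (0 : ℝ)))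
    rw [← closure_Ioi (0 : ℝ)]
    exact closure_minimal h1 isClosed_closure
  have heqOn : Set.EqOn (fun z => condLaplace μ X R r z) (fun z => Λ z r)
      (Set.Ioi (0 : ℝ) ∩ Set.range ((↑) : ℚ → ℝ)) := by
    rintro _ ⟨hz, q, rfl⟩
    exact hr q (le_of_lt hz)
  exact fun z hz => heqOn.of_subset_closure hcl hc hsub hden hz

/-- The conditional Laplace transform of the aggregate interference. -/
lemma condLaplace_aggregateInterference (hx : IsHomogeneousPPP x lam μ)
    (hh : IsRayleighFading h x μ) {P η : ℝ} (hlam : 0 ≤ lam) (hP : 0 ≤ P) (hη : 2 < η) :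
    ∀ᵐ r ∂(μ.map (serviceDistance x)), ∀ z, 0 ≤ z →
      condLaplace μ (aggregateInterference x h P η) (serviceDistance x) r z =
        Real.exp (-interferenceExponent lam η (z * P) r) := by
  refine condLaplace_ae_eq (Λ := fun z r => Real.exp (-interferenceExponent lam η (z * P) r))
    (measurable_aggregateInterference η hx.measurable hh.measurable hP)
    (measurable_serviceDistance hx.measurable)
    (ae_of_all _ fun ω => aggregateInterference_nonneg x h hP η ω)
    (fun z r => (Real.exp_pos _).le) (fun z hz => ?_) ?_ fun z hz A hA => ?_
  · refine (measurable_poissonLaplace_strictOuter lam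
      (measurable_fadedPathLoss (z * P) η)).ennreal_toReal.aemeasurable.congr ?_
    filter_upwards [ae_map_serviceDistance_pos hx] with r hr
    rw [poissonLaplace_fadedPathLoss hlam (mul_nonneg hz hP) hη hr,
      ENNReal.toReal_ofReal (Real.exp_pos _).le]
  · filter_upwards [ae_map_serviceDistance_pos hx] with r hr
    refine Real.continuous_exp.comp_continuousOn (ContinuousOn.neg ?_)
    exact (continuousOn_interferenceExponent lam hη hr).comp (by fun_prop)
      fun z hz => mul_nonneg hz hP
  · rw [← setLIntegral_expNeg_extInterference hx hh hlam hP hz hη hA]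
    refine lintegral_congr_ae (ae_restrict_of_ae ?_)
    filter_upwards [ae_extInterference_ne_top hx hh hlam hP hη] with ω hω
    exact (expNeg_mul_extInterference hP hz hω).symm

end

end CellularPPP

theorem mainTheorem1 {Ω : Type*} [MeasurableSpace Ω] (μ : MeasureTheory.Measure Ω)
    [MeasureTheory.IsProbabilityMeasure μ] (lam P η : ℝ) (hlam : 0 < lam) (hP : 0 < P)
    (hη : 2 < η) (x : ℕ → Ω → CellularPPP.Plane) (h : ℕ → Ω → ℂ)
    (hx : CellularPPP.IsHomogeneousPPP x lam μ) (hh : CellularPPP.IsRayleighFading h x μ) :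
    (∀ᵐ ω ∂μ, 0 < CellularPPP.serviceDistance x ω ∧
      Summable fun k => CellularPPP.interferenceTerm x h P η k ω) ∧
    (∀ᵐ r ∂(μ.map (CellularPPP.serviceDistance x)), ∀ z : ℝ, 0 ≤ z →
      CellularPPP.condLaplace μ (CellularPPP.aggregateInterference x h P η)
          (CellularPPP.serviceDistance x) r z =
        Real.exp (-(2 * Real.pi * lam * z * P * r ^ (2 - η) / (η - 2) *
          CellularPPP.gauss2F1 1 (1 - 2 / η) (2 - 2 / η) (-(z * P / r ^ η))))) ∧
    (η = 4 → ∀ᵐ r ∂(μ.map (CellularPPP.serviceDistance x)), ∀ z : ℝ, 0 ≤ z →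
      CellularPPP.condLaplace μ (CellularPPP.aggregateInterference x h P η)
          (CellularPPP.serviceDistance x) r z =
        Real.exp (-(Real.pi * lam * Real.sqrt (z * P) *
          Real.arctan (Real.sqrt (z * P) / r ^ 2)))) := by
  refine ⟨?_, ?_, ?_⟩
  · filter_upwards [CellularPPP.ae_serviceDistance_pos hx,
      CellularPPP.ae_extInterference_ne_top hx hh hlam.le hP.le hη] with ω h1 h2
    exact ⟨h1, CellularPPP.summable_interferenceTerm hP.le h2⟩
  · filter_upwards [CellularPPP.condLaplace_aggregateInterference hx hh hlam.le hP.le hη,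
      CellularPPP.ae_map_serviceDistance_pos hx] with r h1 hr z hz
    rw [h1 z hz, CellularPPP.interferenceExponent_eq_gauss2F1 lam P z hP.le hz hη hr]
  · rintro rfl
    filter_upwards [CellularPPP.condLaplace_aggregateInterference hx hh hlam.le hP.le hη,
      CellularPPP.ae_map_serviceDistance_pos hx] with r h1 hr z hz
    rw [h1 z hz, CellularPPP.interferenceExponent_four lam (mul_nonneg hz hP.le) hr]
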